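/- Let $k$ be a field and let $H$ be an affine commutative group scheme over $k$. For commutative group schemes $G, G'$ over $k$ let $\underline{\mathrm{Hom}}(G,G')$ denote the contravariant functor $T\mapsto \mathrm{Hom}_T(G_T,G'_T)$ from $k$-schemes to abelian groups, where $G_T, G'_T$ are the base changes to $T$ and $\mathrm{Hom}_T$ is the group of homomorphisms of group schemes over $T$. Then the functors $\underline{\mathrm{Hom}}(-,H)$ and $\underline{\mathrm{Hom}}(H,-)$ on the category $\mathcal A_k$ of affine commutative group schemes over $k$ are left exact. Precisely: (1) The contravariant functor $G\mapsto \underline{\mathrm{Hom}}(G,H)$ from $\mathcal A_k$ to functors on $k$-schemes sends finite colimits to limits; and for every short exact sequence $0\to N\xrightarrow{i} G\xrightarrow{\pi} Q\to 0$ in $\mathcal A_k$ ($\pi$ faithfully flat, $i$ the scheme-theoretic kernel of $\pi$) and every $k$-scheme $T$ the sequence $$0\to \mathrm{Hom}_T(Q_T,H_T)\xrightarrow{\pi^*}\mathrm{Hom}_T(G_T,H_T)\xrightarrow{i^*}\mathrm{Hom}_T(N_T,H_T)$$ is exact. (2) For finite commutative group schemes $G$ over $k$ (these are automatically flat), $\underline{\mathrm{Hom}}(G,H)$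 is representable by an affine commutative group scheme over $k$, functorially in $G$. The resulting contravariant functor from finite commutative group schemes over $k$ to $\mathcal A_k$ sends finite colimits to limits, and for every short exact sequence $0\to N\to G\to Q\to 0$ of finite commutative group schemes the sequence of group schemes $0\to\underline{\mathrm{Hom}}(Q,H)\to\underline{\mathrm{Hom}}(G,H)\to\underline{\mathrm{Hom}}(N,H)$ is exact, i.e. the first map is the scheme-theoretic kernel of the second. (3) The functor $G\mapsto \underline{\mathrm{Hom}}(H,G)$ from $\mathcal A_k$ to functors on $k$-schemes preserves finite limits; and for every exact sequence $0\to N\xrightarrow{i} G\xrightarrow{\pi} Q$ in $\mathcal A_k$ ($i$ the scheme-theoretic kernel of $\pi$) and every $k$-scheme $T$ the sequence $$0\to \mathrm{Hom}_T(H_T,N_T)\xrightarrow{i_*}\mathrm{Hom}_T(H_T,G_T)\xrightarrow{\pi_*}\mathrm{Hom}_T(H_T,Q_T)$$ is exact. (4) If $H$ is finite over $k$, then for $G$ in $\mathcal A_k$ the functor $\underline{\mathrm{Hom}}(H,G)$ is representable by an affine commutative group scheme over $k$, functorially in $G$. The resulting functor $\mathcal A_k\to\mathcal A_k$ preserves finite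 limits, and for every exact sequence $0\to N\to G\to Q$ in $\mathcal A_k$ the sequence of group schemes $0\to\underline{\mathrm{Hom}}(H,N)\to\underline{\mathrm{Hom}}(H,G)\to\underline{\mathrm{Hom}}(H,Q)$ is exact. -/

import Mathlib

open CategoryTheory CategoryTheory.Limits AlgebraicGeometry Opposite MonoidalCategory
  CartesianMonoidalCategory
open scoped MonObj
universe u
noncomputable section
namespace GroupScheme

/-- Transitivity of base change `(X ×_S T) ×_T T' ≅ X ×_S T'`. -/
def pullbackTransIso {X T T' S : Scheme.{u}} (f : X ⟶ S) (a : T ⟶ S) (t : T' ⟶ T) (b : T' ⟶ S)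
    (h : t ≫ a = b) : pullback (pullback.snd f a) t ≅ pullback f b where
  hom := pullback.lift (pullback.fst _ _ ≫ pullback.fst _ _) (pullback.snd _ _) (by
    rw [Category.assoc, pullback.condition, pullback.condition_assoc, h])
  inv := pullback.lift (pullback.lift (pullback.fst _ _) (pullback.snd _ _ ≫ t)
    (by rw [pullback.condition, Category.assoc, h])) (pullback.snd _ _)
    (by rw [pullback.lift_snd])
  hom_inv_id := by
    apply pullback.hom_ext
    · apply pullback.hom_ext
      · simp only [Category.assoc, Category.id_comp, pullback.lift_fst]
      · simp only [Category.assoc, Category.id_comp, pullback.lift_fst, pullback.lift_snd,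
          pullback.lift_snd_assoc, pullback.condition]
    · simp only [Category.assoc, Category.id_comp, pullback.lift_snd]
  inv_hom_id := by
    apply pullback.hom_ext <;>
    simp only [Category.assoc, Category.id_comp, pullback.lift_snd, pullback.lift_fst,
      pullback.lift_fst_assoc]

section
variable {X T T' S : Scheme.{u}} (f : X ⟶ S) (a : T ⟶ S) (t : T' ⟶ T) (b : T' ⟶ S)
    (h : t ≫ a = b)

theorem pullbackTransIso_hom_fst : (pullbackTransIso f a t b h).hom ≫ pullback.fst f b =
    pullback.fst _ _ ≫ pullback.fst _ _ := pullback.lift_fst _ _ _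

theorem pullbackTransIso_hom_snd : (pullbackTransIso f a t b h).hom ≫ pullback.snd f b =
    pullback.snd _ _ := pullback.lift_snd _ _ _

theorem pullbackTransIso_inv_fst : (pullbackTransIso f a t b h).inv ≫ pullback.fst _ _ =
    pullback.lift (pullback.fst _ _) (pullback.snd _ _ ≫ t)
    (by rw [pullback.condition, Category.assoc, h]) := pullback.lift_fst _ _ _

theorem pullbackTransIso_naturality {Y : Scheme.{u}} (g : Y ⟶ S) (w : X ⟶ Y)
    (v : pullback f a ⟶ pullback g a) (h1 : v ≫ pullback.fst _ _ = pullback.fst _ _ ≫ w)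
    (v' : pullback f b ⟶ pullback g b) (h1' : v' ≫ pullback.fst _ _ = pullback.fst _ _ ≫ w)
    (h2' : v' ≫ pullback.snd _ _ = pullback.snd _ _)
    (v'' : pullback (pullback.snd f a) t ⟶ pullback (pullback.snd g a) t)
    (h1'' : v'' ≫ pullback.fst _ _ = pullback.fst _ _ ≫ v)
    (h2'' : v'' ≫ pullback.snd _ _ = pullback.snd _ _) :
    v'' ≫ (pullbackTransIso g a t b h).hom = (pullbackTransIso f a t b h).hom ≫ v' := by
  apply pullback.hom_ext
  · rw [Category.assoc, Category.assoc, pullbackTransIso_hom_fst, h1', reassoc_of% h1'', h1,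
      ← Category.assoc, ← Category.assoc, pullbackTransIso_hom_fst]
  · simp only [Category.assoc, pullbackTransIso_hom_snd, h2', h2'']

/-- The morphism `X ×_S T' ⟶ X ×_S T` induced by `t : T' ⟶ T`. -/
def pullbackProj : pullback f b ⟶ pullback f a :=
  pullback.lift (pullback.fst _ _) (pullback.snd _ _ ≫ t)
    (by rw [pullback.condition, Category.assoc, h])

theorem conj_proj {Y : Scheme.{u}} (g : Y ⟶ S) 
    (v : pullback f a ⟶ pullback g a)
    (v'' : pullback (pullback.snd f a) t ⟶ pullback (pullback.snd g a) t)
    (h1'' : v'' ≫ pullback.fst _ _ = pullback.fst _ _ ≫ v) :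
    ((pullbackTransIso f a t b h).inv ≫ v'' ≫ (pullbackTransIso g a t b h).hom) ≫ 
      pullbackProj g a t b h = pullbackProj f a t b h ≫ v := by
  have e2 : (pullbackTransIso g a t b h).hom ≫ pullbackProj g a t b h = pullback.fst _ _ := by
    rw [← Iso.eq_inv_comp, pullbackTransIso_inv_fst]; rfl
  have e3 : (pullbackTransIso f a t b h).inv ≫ pullback.fst _ _ = pullbackProj f a t b h :=
    pullbackTransIso_inv_fst ..
  rw [Category.assoc, Category.assoc, e2, ← e3, h1'', Category.assoc]

theorem pullbackProj_hom_ext {Z : Scheme.{u}} {p q : Z ⟶ pullback f b}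
   (h1 : p ≫ pullbackProj f a t b h = q ≫ pullbackProj f a t b h)
   (h2 : p ≫ pullback.snd _ _ = q ≫ pullback.snd _ _) : p = q := by
  apply pullback.hom_ext _ h2
  have e : pullbackProj f a t b h ≫ pullback.fst _ _ = pullback.fst _ _ := pullback.lift_fst ..
  rw [← e, reassoc_of% h1]

theorem pullbackProj_id : pullbackProj f a (𝟙 _) a (Category.id_comp _) = 𝟙 _ := by
  apply pullback.hom_ext
  · simp only [pullbackProj, pullback.lift_fst, Category.id_comp]
  · simp only [pullbackProj, pullback.lift_snd, Category.id_comp, Category.comp_id]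

theorem pullbackProj_comp {T'' : Scheme.{u}} (t' : T'' ⟶ T') (c : T'' ⟶ S) (h' : t' ≫ b = c)
   (s : T'' ⟶ T) (hs : t' ≫ t = s) :
    pullbackProj f b t' c h' ≫ pullbackProj f a t b h = 
      pullbackProj f a s c (by rw [← hs, Category.assoc, h, h']) := by
  apply pullback.hom_ext
  · simp only [pullbackProj, Category.assoc, pullback.lift_fst]
  · simp only [pullbackProj, pullback.lift_snd, pullback.lift_snd_assoc, Category.assoc, hs]

theorem pullbackProj_map {Y : Scheme.{u}} (g : Y ⟶ S) (w : X ⟶ Y)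
    (v : pullback f a ⟶ pullback g a) (h1 : v ≫ pullback.fst _ _ = pullback.fst _ _ ≫ w)
    (h2 : v ≫ pullback.snd _ _ = pullback.snd _ _)
    (v' : pullback f b ⟶ pullback g b) (h1' : v' ≫ pullback.fst _ _ = pullback.fst _ _ ≫ w)
    (h2' : v' ≫ pullback.snd _ _ = pullback.snd _ _) :
    v' ≫ pullbackProj g a t b h = pullbackProj f a t b h ≫ v := by
  apply pullback.hom_ext
  · simp only [pullbackProj, Category.assoc, pullback.lift_fst, h1, h1', pullback.lift_fst_assoc]
  · simp only [pullbackProj, pullback.lift_snd, Category.assoc, h2, reassoc_of% h2']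

end

variable {S : Scheme.{u}}

/-- Transitivity of base change, as an isomorphism of functors. -/
def pullbackOverIso {T' T : Over S} (t : T' ⟶ T) :
    Over.pullback T.hom ⋙ Over.pullback t.left ≅ Over.pullback T'.hom :=
  NatIso.ofComponents
    (fun X ↦ Over.isoMk (pullbackTransIso X.hom T.hom t.left T'.hom (Over.w t))
      (pullbackTransIso_hom_snd _ _ _ _ _))
    (fun {X Y} f ↦ Over.OverMorphism.ext <|
      pullbackTransIso_naturality X.hom T.hom t.left T'.hom (Over.w t) Y.hom f.left
        ((Over.pullback T.hom).map f).left (pullback.lift_fst _ _ _)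
        ((Over.pullback T'.hom).map f).left (pullback.lift_fst _ _ _) (pullback.lift_snd _ _ _)
        _ (pullback.lift_fst _ _ _) (pullback.lift_snd _ _ _))

/-- The base change `G ↦ G_T` of commutative group schemes along the structure morphism `T ⟶ S`. -/
def baseChange (T : Over S) : CommGrp (Over S) ⥤ CommGrp (Over T.left) :=
  (Over.pullback T.hom).mapCommGrp

/-- The canonical isomorphism `(G_T)_{T'} ≅ G_{T'}` of commutative group schemes over `T'`. -/
def baseChangeIso {T' T : Over S} (t : T' ⟶ T) :
    baseChange T ⋙ (Over.pullback t.left).mapCommGrp ≅ baseChange T' :=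
  Functor.mapCommGrpCompIso.symm ≪≫ Functor.mapCommGrpNatIso (pullbackOverIso t)

/-- `Hom_T(G_T, H_T)`: homomorphisms of group schemes over `T` from `G_T` to `H_T`. It is a
commutative group under multiplication in `H_T`. -/
abbrev HomOver (G H : CommGrp (Over S)) (T : Over S) : Type u :=
  ((baseChange T).obj G).toGrp ⟶ ((baseChange T).obj H).toGrp

/-- The pullback `Hom_T(G_T, H_T) → Hom_{T'}(G_{T'}, H_{T'})` of homomorphisms along `t : T' ⟶ T`. -/
def restrict (G H : CommGrp (Over S)) {T' T : Over S} (t : T' ⟶ T) (φ : HomOver G H T) :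
    HomOver G H T' :=
  ((baseChangeIso t).inv.app G).hom ≫
    ((Over.pullback t.left).mapCommGrp.map (InducedCategory.homMk φ)).hom ≫
    ((baseChangeIso t).hom.app H).hom

/-- The underlying morphism of schemes of a homomorphism `G_T ⟶ H_T`. -/
def homLeft {G H : CommGrp (Over S)} {T : Over S} (φ : HomOver G H T) :
    pullback G.X.hom T.hom ⟶ pullback H.X.hom T.hom := φ.hom.hom.left

theorem homLeft_injective {G H : CommGrp (Over S)} {T : Over S} {φ ψ : HomOver G H T}
    (h : homLeft φ = homLeft ψ) : φ = ψ :=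
  Grp.hom_ext _ _ (Over.OverMorphism.ext h)

theorem homLeft_snd {G H : CommGrp (Over S)} {T : Over S} (φ : HomOver G H T) :
    homLeft φ ≫ pullback.snd _ _ = pullback.snd _ _ := Over.w φ.hom.hom

/-- The morphism `G_{T'} ⟶ G_T` induced by `t : T' ⟶ T`. -/
abbrev pr (G : CommGrp (Over S)) {T' T : Over S} (t : T' ⟶ T) :
    pullback G.X.hom T'.hom ⟶ pullback G.X.hom T.hom :=
  pullbackProj G.X.hom T.hom t.left T'.hom (Over.w t)

theorem restrict_proj (G H : CommGrp (Over S)) {T' T : Over S} (t : T' ⟶ T) (φ : HomOver G H T) :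
    homLeft (restrict G H t φ) ≫ pr H t = pr G t ≫ homLeft φ := by
  refine Eq.trans ?_ (conj_proj G.X.hom T.hom t.left T'.hom (Over.w t) H.X.hom (homLeft φ)
    ((Over.pullback t.left).map φ.hom.hom).left (pullback.lift_fst _ _ _))
  congr 1

theorem restrict_unique (G H : CommGrp (Over S)) {T' T : Over S} (t : T' ⟶ T) (φ : HomOver G H T)
    (ψ : HomOver G H T') (h : homLeft ψ ≫ pr H t = pr G t ≫ homLeft φ) :
    restrict G H t φ = ψ := by
  apply homLeft_injective
  apply pullbackProj_hom_ext H.X.hom T.hom t.left T'.hom (Over.w t)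
  · exact (restrict_proj G H t φ).trans h.symm
  · rw [homLeft_snd, homLeft_snd]

theorem restrict_id (G H : CommGrp (Over S)) {T : Over S} (φ : HomOver G H T) :
    restrict G H (𝟙 T) φ = φ := by
  apply restrict_unique
  have h (K : CommGrp (Over S)) : pr K (𝟙 T) = 𝟙 _ := pullbackProj_id ..
  rw [h, h, Category.id_comp, Category.comp_id]

theorem pr_comp (G : CommGrp (Over S)) {T'' T' T : Over S} (t' : T'' ⟶ T') (t : T' ⟶ T) :
    pr G (t' ≫ t) = pr G t' ≫ pr G t := (pullbackProj_comp _ _ _ _ _ _ _ _ _ rfl).symm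

theorem restrict_comp (G H : CommGrp (Over S)) {T'' T' T : Over S} (t' : T'' ⟶ T') (t : T' ⟶ T)
    (φ : HomOver G H T) : restrict G H (t' ≫ t) φ = restrict G H t' (restrict G H t φ) := by
  apply restrict_unique
  rw [pr_comp, pr_comp, ← Category.assoc, restrict_proj, Category.assoc, restrict_proj, 
    Category.assoc]

theorem mul_postcomp {G H H' : CommGrp (Over S)} {T : Over S} (φ ψ : HomOver G H T)
    (f : (baseChange T).obj H ⟶ (baseChange T).obj H') :
    (φ * ψ) ≫ f.hom = (φ ≫ f.hom) * (ψ ≫ f.hom) :=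
  MonObj.mul_comp φ ψ f.hom

theorem precomp_mul {G G' H : CommGrp (Over S)} {T : Over S}
    (f : (baseChange T).obj G' ⟶ (baseChange T).obj G) (φ ψ : HomOver G H T) :
    f.hom ≫ (φ * ψ) = (f.hom ≫ φ) * (f.hom ≫ ψ) :=
  MonObj.comp_mul f.hom φ ψ

theorem restrict_mul (G H : CommGrp (Over S)) {T' T : Over S} (t : T' ⟶ T) (φ ψ : HomOver G H T) :
    restrict G H t (φ * ψ) = restrict G H t φ * restrict G H t ψ := by
  let F (x : HomOver G H T) :
      ((Over.pullback t.left).mapCommGrp.obj ((baseChange T).obj G)).toGrp ⟶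
        ((Over.pullback t.left).mapCommGrp.obj ((baseChange T).obj H)).toGrp :=
    ((Over.pullback t.left).mapCommGrp.map (InducedCategory.homMk x)).hom
  have h : F (φ * ψ) = F φ * F ψ :=
    Grp.hom_ext _ _ (Functor.map_mul (Over.pullback t.left) φ.hom.hom ψ.hom.hom)
  have h1 := MonObj.mul_comp (F φ) (F ψ) ((baseChangeIso t).hom.app H).hom
  refine Eq.trans (congr_arg (fun x ↦ ((baseChangeIso t).inv.app G).hom ≫ x ≫
    ((baseChangeIso t).hom.app H).hom) h) ?_
  refine Eq.trans (congr_arg (fun x ↦ ((baseChangeIso t).inv.app G).hom ≫ x) h1) ?_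
  exact MonObj.comp_mul _ _ _

/-- The inner Hom of `G` and `H`: the contravariant functor `T ↦ Hom_T(G_T, H_T)` from schemes
over `S` to abelian groups (written multiplicatively). -/
def innerHomPresheaf (G H : CommGrp (Over S)) : (Over S)ᵒᵖ ⥤ CommGrpCat.{u} where
  obj T := CommGrpCat.of (HomOver G H T.unop)
  map t := CommGrpCat.ofHom (MonoidHom.mk' (restrict G H t.unop) (restrict_mul G H t.unop))
  map_id _ := CommGrpCat.hom_ext (MonoidHom.ext fun φ ↦ restrict_id G H φ)
  map_comp t t' := CommGrpCat.hom_ext (MonoidHom.ext fun φ ↦ restrict_comp G H t'.unop t.unop φ)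

theorem pr_naturality {G H : CommGrp (Over S)} (f : G ⟶ H) {T' T : Over S} (t : T' ⟶ T) :
    homLeft ((baseChange T').map f).hom ≫ pr H t = pr G t ≫ homLeft ((baseChange T).map f).hom :=
  pullbackProj_map _ _ _ _ _ _ f.hom.hom.hom.left _ (pullback.lift_fst _ _ _)
    (pullback.lift_snd _ _ _) _ (pullback.lift_fst _ _ _) (pullback.lift_snd _ _ _)

theorem restrict_postcomp {G H H' : CommGrp (Over S)} (f : H ⟶ H') {T' T : Over S} (t : T' ⟶ T)
    (φ : HomOver G H T) : restrict G H' t (φ ≫ ((baseChange T).map f).hom) =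
      restrict G H t φ ≫ ((baseChange T').map f).hom := by
  apply restrict_unique
  change (homLeft (restrict G H t φ) ≫ homLeft ((baseChange T').map f).hom) ≫ pr H' t =
    pr G t ≫ homLeft φ ≫ homLeft ((baseChange T).map f).hom
  rw [Category.assoc, pr_naturality, ← Category.assoc, restrict_proj, Category.assoc]

theorem restrict_precomp {G G' H : CommGrp (Over S)} (g : G' ⟶ G) {T' T : Over S} (t : T' ⟶ T)
    (φ : HomOver G H T) : restrict G' H t (((baseChange T).map g).hom ≫ φ) =
      ((baseChange T').map g).hom ≫ restrict G H t φ := by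
  apply restrict_unique
  change (homLeft ((baseChange T').map g).hom ≫ homLeft (restrict G H t φ)) ≫ pr H t =
    pr G' t ≫ homLeft ((baseChange T).map g).hom ≫ homLeft φ
  rw [Category.assoc, restrict_proj, ← Category.assoc, pr_naturality, Category.assoc]

/-- Composition with `f : H ⟶ H'` on inner Homs. -/
def innerHomMapRight (G : CommGrp (Over S)) {H H' : CommGrp (Over S)} (f : H ⟶ H') :
    innerHomPresheaf G H ⟶ innerHomPresheaf G H' where
  app T := CommGrpCat.ofHom (MonoidHom.mk'
    (fun φ : HomOver G H T.unop ↦ φ ≫ ((baseChange T.unop).map f).hom)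
    (fun φ ψ ↦ mul_postcomp φ ψ _))
  naturality _ _ t := CommGrpCat.hom_ext (MonoidHom.ext fun φ ↦ (restrict_postcomp f t.unop φ).symm)

/-- Composition with `g : G' ⟶ G` on inner Homs. -/
def innerHomMapLeft {G G' : CommGrp (Over S)} (g : G' ⟶ G) (H : CommGrp (Over S)) :
    innerHomPresheaf G H ⟶ innerHomPresheaf G' H where
  app T := CommGrpCat.ofHom (MonoidHom.mk'
    (fun φ : HomOver G H T.unop ↦ ((baseChange T.unop).map g).hom ≫ φ)
    (fun φ ψ ↦ precomp_mul _ φ ψ))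
  naturality _ _ t := CommGrpCat.hom_ext (MonoidHom.ext fun φ ↦ (restrict_precomp g t.unop φ).symm)

variable (S) in
/-- The inner Hom as a bifunctor, contravariant in `G` and covariant in `H`. -/
def innerHom : (CommGrp (Over S))ᵒᵖ ⥤ CommGrp (Over S) ⥤ (Over S)ᵒᵖ ⥤ CommGrpCat.{u} where
  obj G :=
    { obj H := innerHomPresheaf G.unop H
      map f := innerHomMapRight G.unop f
      map_id H := by
        ext T : 2
        exact CommGrpCat.hom_ext (MonoidHom.ext fun (φ : HomOver G.unop H T.unop) ↦ by
          change φ ≫ ((baseChange T.unop).map (𝟙 H)).hom = φ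
          rw [CategoryTheory.Functor.map_id]; exact Category.comp_id φ)
      map_comp f f' := by
        ext T : 2
        exact CommGrpCat.hom_ext (MonoidHom.ext fun (φ : HomOver G.unop _ T.unop) ↦ by
          change φ ≫ ((baseChange T.unop).map (f ≫ f')).hom = (φ ≫ _) ≫ _
          rw [CategoryTheory.Functor.map_comp]; exact (Category.assoc φ _ _).symm) }
  map g :=
    { app H := innerHomMapLeft g.unop H
      naturality H H' f := by
        ext T : 2
        exact CommGrpCat.hom_ext (MonoidHom.ext fun (φ : HomOver _ H T.unop) ↦
          (Category.assoc _ φ _).symm) }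
  map_id G := by
    ext H T : 4
    exact CommGrpCat.hom_ext (MonoidHom.ext fun (φ : HomOver G.unop H T.unop) ↦ by
      change ((baseChange T.unop).map (𝟙 G.unop)).hom ≫ φ = φ
      rw [CategoryTheory.Functor.map_id]; exact Category.id_comp φ)
  map_comp {G G' G''} g g' := by
    ext H T : 4
    exact CommGrpCat.hom_ext (MonoidHom.ext fun (φ : HomOver G.unop H T.unop) ↦ by
      change ((baseChange T.unop).map (g'.unop ≫ g.unop)).hom ≫ φ = _ ≫ _ ≫ φ
      rw [CategoryTheory.Functor.map_comp]; exact (Category.assoc _ _ φ))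

variable (S) in
/-- The functor of points `T ↦ G(T)` of a commutative group scheme `G` over `S`. -/
def functorOfPoints : CommGrp (Over S) ⥤ (Over S)ᵒᵖ ⥤ CommGrpCat.{u} where
  obj G :=
    { obj T := CommGrpCat.of (T.unop ⟶ G.X)
      map t := CommGrpCat.ofHom (MonoidHom.mk' (fun x : _ ⟶ G.X ↦ t.unop ≫ x)
        (fun x y ↦ MonObj.comp_mul t.unop x y))
      map_id _ := CommGrpCat.hom_ext (MonoidHom.ext fun x ↦ Category.id_comp x)
      map_comp _ _ := CommGrpCat.hom_ext (MonoidHom.ext fun x ↦ Category.assoc _ _ x) }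
  map {G H} f :=
    { app T := CommGrpCat.ofHom (MonoidHom.mk' (fun x : T.unop ⟶ G.X ↦ x ≫ f.hom.hom.hom)
        (fun x y ↦ MonObj.mul_comp x y f.hom.hom.hom))
      naturality _ _ t := CommGrpCat.hom_ext (MonoidHom.ext fun (x : _ ⟶ G.X) ↦
        Category.assoc t.unop x f.hom.hom.hom) }
  map_id G := by
    ext T : 2
    exact CommGrpCat.hom_ext (MonoidHom.ext fun (x : T.unop ⟶ G.X) ↦ Category.comp_id x)
  map_comp {G _ _} f g := by
    ext T : 2
    exact CommGrpCat.hom_ext (MonoidHom.ext fun (x : T.unop ⟶ G.X) ↦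
      (Category.assoc x f.hom.hom.hom g.hom.hom.hom).symm)

/-- The sequence `0 ⟶ N ⟶ G ⟶ Q` of commutative group schemes is exact: `i` is the
(scheme-theoretic) kernel of `π`, that is, the fibre of `π` over the unit section of `Q`. -/
def IsKernel {N G Q : CommGrp (Over S)} (i : N ⟶ G) (π : G ⟶ Q) : Prop :=
  IsPullback i.hom.hom.hom (toUnit N.X) π.hom.hom.hom η[Q.X]

/-- The sequence `0 ⟶ N ⟶ G ⟶ Q ⟶ 0` of affine commutative group schemes is exact: `i` is the
kernel of `π`, and `π` is faithfully flat. -/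
structure IsShortExact {N G Q : CommGrp (Over S)} (i : N ⟶ G) (π : G ⟶ Q) : Prop where
  isKernel : IsKernel i π
  flat : Flat π.hom.hom.hom.left
  surjective : Surjective π.hom.hom.hom.left

/-- The sequence `0 ⟶ P ⟶ Q ⟶ R` of contravariant functors from `S`-schemes to abelian groups is
exact: `0 ⟶ P(T) ⟶ Q(T) ⟶ R(T)` is an exact sequence of abelian groups for every `T`. -/
def IsLeftExactSeq {P Q R : (Over S)ᵒᵖ ⥤ CommGrpCat.{u}} (α : P ⟶ Q) (β : Q ⟶ R) : Prop :=
  ∀ T : Over S, Function.Injective (α.app (op T)).hom ∧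
    (α.app (op T)).hom.range = (β.app (op T)).hom.ker

/-- The property of a commutative group scheme over `k` of being affine. -/
def isAffineGroup (k : Type u) [Field k] : ObjectProperty (CommGrp (Over (Spec (.of k)))) :=
  fun G ↦ IsAffine G.X.left

/-- The property of a commutative group scheme over `k` of being finite over `k` (flatness is
automatic over a field). -/
def isFiniteGroup (k : Type u) [Field k] : ObjectProperty (CommGrp (Over (Spec (.of k)))) :=
  fun G ↦ IsFinite G.X.hom

theorem isFiniteGroup_le (k : Type u) [Field k] : isFiniteGroup k ≤ isAffineGroup k := by
  intro G (hG : IsFinite G.X.hom)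
  exact isAffine_of_isAffineHom G.X.hom

/-- The category of affine commutative group schemes over `k`. -/
abbrev AffGrp (k : Type u) [Field k] := (isAffineGroup k).FullSubcategory

/-- The category of finite commutative group schemes over `k`. -/
abbrev FinGrp (k : Type u) [Field k] := (isFiniteGroup k).FullSubcategory

variable {k : Type u} [Field k]

/-- The contravariant functor `G ↦ (T ↦ Hom_T(G_T, H_T))` on affine commutative group schemes. -/
def homInto (H : AffGrp k) : (AffGrp k)ᵒᵖ ⥤ (Over (Spec (.of k)))ᵒᵖ ⥤ CommGrpCat.{u} :=
  (isAffineGroup k).ι.op ⋙ (innerHom (Spec (.of k))).flip.obj H.obj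

/-- The covariant functor `G ↦ (T ↦ Hom_T(H_T, G_T))` on affine commutative group schemes. -/
def homFrom (H : AffGrp k) : AffGrp k ⥤ (Over (Spec (.of k)))ᵒᵖ ⥤ CommGrpCat.{u} :=
  (isAffineGroup k).ι ⋙ (innerHom (Spec (.of k))).obj (op H.obj)

/-- The contravariant functor `G ↦ (T ↦ Hom_T(G_T, H_T))` on finite commutative group schemes. -/
def finHomInto (H : AffGrp k) : (FinGrp k)ᵒᵖ ⥤ (Over (Spec (.of k)))ᵒᵖ ⥤ CommGrpCat.{u} :=
  (ObjectProperty.ιOfLE (isFiniteGroup_le k)).op ⋙ homInto H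

/-- The functor `F`, with values in affine commutative group schemes, represents `Φ`: there are
isomorphisms of abelian groups `F(X)(T) ≅ Φ(X)(T)` natural in `X` and in the `k`-scheme `T`. -/
def Represents {D : Type*} [Category* D] (F : D ⥤ AffGrp k)
    (Φ : D ⥤ (Over (Spec (.of k)))ᵒᵖ ⥤ CommGrpCat.{u}) : Prop :=
  Nonempty (F ⋙ (isAffineGroup k).ι ⋙ functorOfPoints (Spec (.of k)) ≅ Φ)

end GroupScheme

end

open GroupScheme

noncomputable section
namespace GroupScheme

/-! ### Homomorphisms over `T` as families `G × T ⟶ H` -/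

section

section Family
variable {C : Type*} [Category* C] [CartesianMonoidalCategory C]

/-! A homomorphism `G_T ⟶ H_T` is the same thing as a morphism `G × T ⟶ H` over the base that is
multiplicative in `G` (`exists_toFamily_eq`, `isHomFamily_toFamily`). In this form, restriction
along `T' ⟶ T` and composition with homomorphisms are plain compositions, and base change disappears
from the argument.

For `Hom(-, H)` the point is descent along quotients. Given `f, g : N ⟶ G`, let `Z` be the spectrum
of the ring of functions on `G` whose translates by `f(n)` and `g(n)` agree. Tensoring over a field
is exact, so `G × T ⟶ Z × T` keeps the coequalizer property for maps to affine schemes, first for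
affine `T`, then by gluing for all `T`. Cancelling products of `G ⟶ Z` makes `Z` a group and makes
descended families multiplicative (`exists_quotient`). Applied to a product `G × G'` this yields
pushouts that `Hom_T(-, H)` turns into fibre products for every `T` (`exists_pushout`); together
with the trivial group they account for all finite colimits. In a short exact sequence, faithfully
flat descent shows that `π` is itself such a quotient, by translations under `N`
(`isUniversalCoequalizer_of_isShortExact`).

For `Hom(H, -)`, fibre products of groups are fibre products of schemes, and a family into one is
multiplicative as soon as both components are (`existsUnique_homOver_postcomp`). Kernels are fibre
products with the trivial group.

If `G` is finite, coordinates in a basis of its algebra turn morphisms `G × T ⟶ H` into solutions of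
polynomial equations over `T` (`exists_universal_algHom`), and multiplicativity cuts out an
equalizer of affine schemes (`exists_affine_homFamilyScheme`). Since `functorOfPoints` is fully
faithful, it reflects finite limits, and the results on functors pass to the representing groups. -/

/-- A morphism `G ⊗ T ⟶ H` that is, pointwise in `T`, a homomorphism from `G` to `H`. -/
def IsHomFamily {G H T : C} [MonObj G] [MonObj H] (f : G ⊗ T ⟶ H) : Prop :=
  ∀ ⦃Y : C⦄ (x y : Y ⟶ G) (t : Y ⟶ T), lift (x * y) t ≫ f = (lift x t ≫ f) * (lift y t ≫ f)

/-- Preservation of the unit is automatic for groups, from `f(1) = f(1) f(1)`; multiplicativity is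
tested at the universal pair of points `fst`, `snd`. -/
theorem isMonHom_of_comp_mul {G H : C} [GrpObj G] [GrpObj H] (f : G ⟶ H)
    (hf : ∀ ⦃Y : C⦄ (x y : Y ⟶ G), (x * y) ≫ f = (x ≫ f) * (y ≫ f)) : IsMonHom f where
  one_hom := by
    have h := hf (1 : 𝟙_ C ⟶ G) 1
    rw [mul_one, left_eq_mul] at h
    simpa [MonObj.one_eq_one] using h
  mul_hom := by
    rw [MonObj.mul_eq_mul, hf, Hom.mul_def]
    congr 1
    ext <;> simp

end Family

variable {S : Scheme.{u}}

/-- The morphism of `S`-schemes corresponding to a morphism of `T`-schemes into a base change. -/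
def adjunct {T : Over S} {G : CommGrp (Over S)} {Y : Over T.left}
    (z : Y ⟶ ((baseChange T).obj G).X) : (Over.map T.hom).obj Y ⟶ G.X :=
  ((Over.mapPullbackAdj T.hom).homEquiv Y G.X).symm z

theorem adjunct_left {T : Over S} {G : CommGrp (Over S)} {Y : Over T.left}
    (z : Y ⟶ ((baseChange T).obj G).X) : (adjunct z).left = z.left ≫ pullback.fst _ _ := by
  simp [adjunct, Over.mapPullbackAdj]
  rfl

theorem adjunct_injective {T : Over S} {G : CommGrp (Over S)} {Y : Over T.left} :
    Function.Injective (adjunct : (Y ⟶ ((baseChange T).obj G).X) → _) :=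
  ((Over.mapPullbackAdj T.hom).homEquiv Y G.X).symm.injective

/-- The inverse bijection applies the product-preserving functor `Over.pullback T.hom` and composes
with the unit of the adjunction; both steps respect products of points. -/
theorem adjunct_mul {T : Over S} {G : CommGrp (Over S)} {Y : Over T.left}
    (z w : Y ⟶ ((baseChange T).obj G).X) : adjunct (z * w) = adjunct z * adjunct w := by
  let adj := Over.mapPullbackAdj T.hom
  let e : (_ ⟶ G.X) ≃ (Y ⟶ ((baseChange T).obj G).X) := adj.homEquiv Y G.X
  have he (x) : e x = adj.unit.app Y ≫ (Over.pullback T.hom).map x := adj.homEquiv_unit _ _ x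
  refine (Equiv.symm_apply_eq e).2 ?_
  have h1 : z = e (adjunct z) := (e.apply_symm_apply z).symm
  have h2 : w = e (adjunct w) := (e.apply_symm_apply w).symm
  have h := Functor.map_mul (Over.pullback T.hom) (adjunct z) (adjunct w)
  rw [he, h]
  refine Eq.trans ?_ (MonObj.comp_mul (adj.unit.app Y) _ _).symm
  refine congr_arg₂ (fun a b : Y ⟶ ((baseChange T).obj G).X ↦ a * b) ?_ ?_
  · rw [he] at h1; exact h1
  · rw [he] at h2; exact h2

/-- The morphism `G ×_S T ⟶ H` corresponding to a homomorphism `G_T ⟶ H_T`. -/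
def toFamily {G H : CommGrp (Over S)} {T : Over S} (φ : HomOver G H T) : G.X ⊗ T ⟶ H.X :=
  Over.homMk (homLeft φ ≫ pullback.fst _ _) (by
    change (homLeft φ ≫ pullback.fst _ _) ≫ H.X.hom = pullback.fst _ _ ≫ G.X.hom
    rw [Category.assoc, pullback.condition, reassoc_of% (homLeft_snd φ), pullback.condition])

theorem toFamily_left {G H : CommGrp (Over S)} {T : Over S} (φ : HomOver G H T) :
    (toFamily φ).left = homLeft φ ≫ pullback.fst _ _ := rfl

theorem toFamily_injective {G H : CommGrp (Over S)} {T : Over S} :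
    Function.Injective (toFamily : HomOver G H T → _) := by
  intro φ ψ h
  apply homLeft_injective
  apply pullback.hom_ext
  · exact congr_arg CommaMorphism.left h
  · rw [homLeft_snd, homLeft_snd]

/-- The point of a base change with given coordinates. -/
def pointOver {X Y T : Over S} (x : Y ⟶ X) (t : Y ⟶ T) :
    Over.mk t.left ⟶ (Over.pullback T.hom).obj X :=
  Over.homMk (pullback.lift x.left t.left (x.w.trans t.w.symm)) (pullback.lift_snd _ _ _)

theorem adjunct_comp_left {G H : CommGrp (Over S)} {T : Over S}
    {Y : Over T.left} (z : Y ⟶ ((baseChange T).obj G).X)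
    (f : ((baseChange T).obj G).X ⟶ ((baseChange T).obj H).X) :
    (adjunct (z ≫ f)).left = z.left ≫ f.left ≫ pullback.fst _ _ := by
  rw [adjunct_left]; exact Category.assoc _ _ _

/-- The structure morphism of a scheme over `T` as a morphism over `S`. -/
def structureHom {T : Over S} (Y : Over T.left) : (Over.map T.hom).obj Y ⟶ T :=
  Over.homMk Y.hom

/-- The dictionary between the two viewpoints: a point of `G_T` over a `T`-scheme is a point of `G`
together with the structure map to `T`, and evaluating the family there computes the morphism over
`T`. -/
theorem lift_adjunct_structureHom {G H : CommGrp (Over S)} {T : Over S}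
    {Y : Over T.left} (z : Y ⟶ ((baseChange T).obj G).X)
    (f : ((baseChange T).obj G).X ⟶ ((baseChange T).obj H).X)
    (f' : G.X ⊗ T ⟶ H.X) (hf : f'.left = f.left ≫ pullback.fst _ _) :
    lift (adjunct z) (structureHom Y) ≫ f' = adjunct (z ≫ f) := by
  apply Over.OverMorphism.ext
  rw [adjunct_comp_left, Over.comp_left, hf]
  refine congr_arg (· ≫ f.left ≫ pullback.fst _ _) ?_
  apply pullback.hom_ext
  · rw [Over.lift_left, pullback.lift_fst, adjunct_left]
    rfl
  · rw [Over.lift_left, pullback.lift_snd]; exact (Over.w z).symm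

/-- The homomorphism `G_T ⟶ H_T` corresponding to a family of homomorphisms `G ×_S T ⟶ H`. -/
theorem exists_toFamily_eq {G H : CommGrp (Over S)} {T : Over S} {f : G.X ⊗ T ⟶ H.X}
    (hf : IsHomFamily f) : ∃ φ : HomOver G H T, toFamily φ = f := by
  let g : ((baseChange T).obj G).X ⟶ ((baseChange T).obj H).X :=
    Over.homMk (pullback.lift f.left (pullback.snd _ _) ((Over.w f).trans pullback.condition))
      (pullback.lift_snd _ _ _)
  have hg : f.left = g.left ≫ pullback.fst _ _ := (pullback.lift_fst _ _ _).symm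
  -- By injectivity and multiplicativity of `adjunct`, this is the family condition at points whose
  -- `T`-coordinate is the structure map.
  have hm : IsMonHom g := isMonHom_of_comp_mul g fun Y z w ↦ by
    apply adjunct_injective
    rw [adjunct_mul, ← lift_adjunct_structureHom _ g f hg, adjunct_mul, hf,
      lift_adjunct_structureHom _ g f hg, lift_adjunct_structureHom _ g f hg]
  exact ⟨Grp.homMk g, Over.OverMorphism.ext ((toFamily_left _).trans hg.symm)⟩

/-- A point `t : Y ⟶ T` makes `Y` a `T`-scheme, so `(x, t)` is a point of `G_T`, where `φ` is
multiplicative. -/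
theorem isHomFamily_toFamily {G H : CommGrp (Over S)} {T : Over S} (φ : HomOver G H T) :
    IsHomFamily (toFamily φ) := by
  intro Y x y t
  -- The identity on underlying schemes; the structure maps agree only up to the equation `Over.w
  -- t`.
  let e : (Over.map T.hom).obj (Over.mk t.left) ≅ Y := Over.isoMk (Iso.refl _) (by simp)
  let p (x : Y ⟶ G.X) : Over.mk t.left ⟶ ((baseChange T).obj G).X := pointOver x t
  have hp (x : Y ⟶ G.X) : adjunct (p x) = e.hom ≫ x := by
    apply Over.OverMorphism.ext
    rw [adjunct_left]
    exact (pullback.lift_fst _ _ _).trans (Category.id_comp _).symm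
  have hs : structureHom (Over.mk t.left) = e.hom ≫ t := by
    apply Over.OverMorphism.ext; exact (Category.id_comp _).symm
  have h2 (x : Y ⟶ G.X) : e.hom ≫ lift x t ≫ toFamily φ = adjunct (p x ≫ φ.hom.hom) := by
    rw [← lift_adjunct_structureHom (p x) φ.hom.hom (toFamily φ) rfl, hs, hp,
      comp_lift_assoc]
  rw [← cancel_epi e.hom, MonObj.comp_mul, h2, h2, h2, ← adjunct_mul]
  congr 1
  have : p (x * y) = p x * p y := by
    apply adjunct_injective
    rw [adjunct_mul, hp, hp, hp, MonObj.comp_mul]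
  rw [this]
  exact MonObj.mul_comp (p x) (p y) φ.hom.hom

theorem toFamily_mul {G H : CommGrp (Over S)} {T : Over S} (φ ψ : HomOver G H T) :
    toFamily (φ * ψ) = toFamily φ * toFamily ψ := by
  let e : G.X ⊗ T ≅ (Over.map T.hom).obj ((baseChange T).obj G).X :=
    Over.isoMk (Iso.refl _) ((Category.id_comp _).trans pullback.condition.symm)
  have h (φ : HomOver G H T) : toFamily φ = e.hom ≫ adjunct φ.hom.hom := by
    apply Over.OverMorphism.ext
    rw [toFamily_left, Over.comp_left, adjunct_left]
    exact (Category.id_comp _).symm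
  rw [h, h, h, ← MonObj.comp_mul, ← adjunct_mul]
  rfl

theorem toFamily_restrict {G H : CommGrp (Over S)} {T' T : Over S} (t : T' ⟶ T)
    (φ : HomOver G H T) : toFamily (restrict G H t φ) = G.X ◁ t ≫ toFamily φ := by
  apply Over.OverMorphism.ext
  have h : pr H t ≫ pullback.fst _ _ = pullback.fst _ _ := pullback.lift_fst _ _ _
  rw [toFamily_left, ← h, reassoc_of% restrict_proj]
  refine congr_arg (· ≫ homLeft φ ≫ pullback.fst _ _) ?_
  apply pullback.hom_ext
  · refine (pullback.lift_fst _ _ _).trans ?_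
    simp
  · refine (pullback.lift_snd _ _ _).trans ?_
    simp

theorem toFamily_precomp {G G' H : CommGrp (Over S)} {T : Over S} (g : G' ⟶ G)
    (φ : HomOver G H T) : toFamily (((baseChange T).map g).hom ≫ φ) =
      g.hom.hom.hom ▷ T ≫ toFamily φ := by
  apply Over.OverMorphism.ext
  refine (Category.assoc _ _ _).trans ?_
  refine congr_arg (· ≫ homLeft φ ≫ pullback.fst _ _) ?_
  apply pullback.hom_ext
  · exact (pullback.lift_fst _ _ _).trans (Over.whiskerRight_left_fst _).symm
  · exact (pullback.lift_snd _ _ _).trans (Over.whiskerRight_left_snd _).symm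

theorem toFamily_postcomp {G H H' : CommGrp (Over S)} {T : Over S} (g : H ⟶ H')
    (φ : HomOver G H T) : toFamily (φ ≫ ((baseChange T).map g).hom) =
      toFamily φ ≫ g.hom.hom.hom := by
  apply Over.OverMorphism.ext
  refine (Category.assoc _ _ _).trans ?_
  refine (congr_arg (homLeft φ ≫ ·) (pullback.lift_fst _ _ _)).trans ?_
  exact (Category.assoc _ _ _).symm

end

/-! ### Gluing morphisms out of `Y × T` along covers of `T` -/

section

section Gluing
variable {S : Scheme.{u}} {T Y W : Over S}

/-- The scheme underlying `Y ×_S T'` as a pullback of `Y ×_S T`. -/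
def whiskerPullbackIso (Y : Over S) {T T' : Over S} (t : T' ⟶ T) :
    pullback (pullback.snd Y.hom T.hom) t.left ≅ (Y ⊗ T').left :=
  pullbackTransIso Y.hom T.hom t.left T'.hom (Over.w t)

theorem whiskerPullbackIso_hom_whiskerLeft (Y : Over S) {T T' : Over S} (t : T' ⟶ T) :
    (whiskerPullbackIso Y t).hom ≫ (Y ◁ t).left = pullback.fst _ _ := by
  rw [← Iso.eq_inv_comp]
  exact (pullbackTransIso_inv_fst Y.hom T.hom t.left T'.hom (Over.w t)).symm

theorem map_whiskerPullbackIso_hom (Y : Over S) {T T' T'' : Over S} (t : T' ⟶ T) (s : T'' ⟶ T')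
    (t' : T'' ⟶ T)
    (m : pullback (pullback.snd Y.hom T.hom) t'.left ⟶ pullback (pullback.snd Y.hom T.hom) t.left)
    (h1 : m ≫ pullback.fst _ _ = pullback.fst _ _)
    (h2 : m ≫ pullback.snd _ _ = pullback.snd _ _ ≫ s.left) :
    m ≫ (whiskerPullbackIso Y t).hom = (whiskerPullbackIso Y t').hom ≫ (Y ◁ s).left := by
  have e1 : (whiskerPullbackIso Y t).hom ≫ pullback.fst _ _ = _ := pullbackTransIso_hom_fst ..
  have e2 : (whiskerPullbackIso Y t).hom ≫ pullback.snd _ _ = _ := pullbackTransIso_hom_snd ..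
  have e1' : (whiskerPullbackIso Y t').hom ≫ pullback.fst _ _ = _ := pullbackTransIso_hom_fst ..
  have e2' : (whiskerPullbackIso Y t').hom ≫ pullback.snd _ _ = _ := pullbackTransIso_hom_snd ..
  refine pullback.hom_ext (f := Y.hom) (g := T'.hom) ?_ ?_
  · rw [Category.assoc, Category.assoc, e1, Over.whiskerLeft_left_fst, e1', reassoc_of% h1]
  · rw [Category.assoc, Category.assoc, e2, Over.whiskerLeft_left_snd, reassoc_of% e2', h2]

section
variable (𝒱 : T.left.OpenCover)

/-- The members of an open cover of an `S`-scheme, as `S`-schemes. -/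
abbrev coverOver (i : 𝒱.I₀) : Over S := Over.mk (𝒱.f i ≫ T.hom)

/-- The maps of an open cover of an `S`-scheme, as morphisms of `S`-schemes. -/
abbrev coverOverι (i : 𝒱.I₀) : coverOver 𝒱 i ⟶ T := Over.homMk (𝒱.f i)

theorem hom_ext_of_cover {g g' : Y ⊗ T ⟶ W}
    (h : ∀ i, Y ◁ coverOverι 𝒱 i ≫ g = Y ◁ coverOverι 𝒱 i ≫ g') : g = g' := by
  apply Over.OverMorphism.ext
  apply (𝒱.pullback₁ (pullback.snd Y.hom T.hom)).hom_ext
  intro i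
  have h1 := congr_arg CommaMorphism.left (h i)
  have h2 := whiskerPullbackIso_hom_whiskerLeft Y (coverOverι 𝒱 i)
  change pullback.fst (pullback.snd Y.hom T.hom) (coverOverι 𝒱 i).left ≫ _ =
    pullback.fst (pullback.snd Y.hom T.hom) (coverOverι 𝒱 i).left ≫ _
  rw [← h2, Category.assoc, Category.assoc]
  exact congr_arg (_ ≫ ·) h1

variable [Category* 𝒱.I₀] [𝒱.LocallyDirected]

/-- The transition maps of a directed open cover of an `S`-scheme, as morphisms of `S`-schemes. -/
abbrev coverOverTrans {i j : 𝒱.I₀} (h : i ⟶ j) : coverOver 𝒱 i ⟶ coverOver 𝒱 j :=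
  Over.homMk (Scheme.Cover.trans 𝒱 h)
    ((Category.assoc _ _ _).symm.trans (congr_arg (· ≫ T.hom) (Scheme.Cover.trans_map 𝒱 h)))

/-- The cover of `T` pulls back along the projection to a cover of `Y × T`, with members identified
with the `Y × Tᵢ` by `whiskerPullbackIso`. Because the cover is locally directed, agreement along
transition maps replaces agreement on overlaps. -/
theorem exists_glue_of_cover (f : ∀ i, Y ⊗ coverOver 𝒱 i ⟶ W)
    (hf : ∀ ⦃i j⦄ (h : i ⟶ j), Y ◁ coverOverTrans 𝒱 h ≫ f j = f i) :
    ∃ g : Y ⊗ T ⟶ W, ∀ i, Y ◁ coverOverι 𝒱 i ≫ g = f i := by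
  let q (i) : (𝒱.pullback₁ (pullback.snd Y.hom T.hom)).X i ⟶ W.left :=
    (whiskerPullbackIso Y (coverOverι 𝒱 i)).hom ≫ (f i).left
  have hq {i j : (𝒱.pullback₁ (pullback.snd Y.hom T.hom)).I₀} (h : i ⟶ j) :
      Scheme.Cover.trans (𝒱.pullback₁ (pullback.snd Y.hom T.hom)) h ≫ q j = q i := by
    have h1 := congr_arg CommaMorphism.left (hf h)
    have h2 := map_whiskerPullbackIso_hom Y (coverOverι 𝒱 j) (coverOverTrans 𝒱 h)
      (coverOverι 𝒱 i) (Scheme.Cover.trans (𝒱.pullback₁ (pullback.snd Y.hom T.hom)) h)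
      ((pullback.lift_fst _ _ _).trans (Category.comp_id _)) (pullback.lift_snd _ _ _)
    exact (Category.assoc _ _ _).symm.trans ((congr_arg (· ≫ (f j).left) h2).trans
      ((Category.assoc _ _ _).trans (congr_arg (_ ≫ ·) h1)))
  have hw (i) : q i ≫ W.hom = (𝒱.pullback₁ (pullback.snd Y.hom T.hom)).f i ≫ (Y ⊗ T).hom := by
    have h2 := whiskerPullbackIso_hom_whiskerLeft Y (coverOverι 𝒱 i)
    change (_ ≫ _) ≫ _ = pullback.fst (pullback.snd Y.hom T.hom) (coverOverι 𝒱 i).left ≫ _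
    rw [← h2, Category.assoc, Over.w (f i), Category.assoc, Over.w]
  obtain ⟨g, hg⟩ : ∃ g : Y ⊗ T ⟶ W, ∀ i,
      (𝒱.pullback₁ (pullback.snd Y.hom T.hom)).f i ≫ g.left = q i := by
    refine ⟨Over.homMk (Scheme.OpenCover.glueMorphismsOfLocallyDirected
      (𝒱.pullback₁ (pullback.snd Y.hom T.hom)) q hq) ?_, fun i ↦ ?_⟩
    · apply (𝒱.pullback₁ (pullback.snd Y.hom T.hom)).hom_ext
      intro i
      rw [← hw, ← Category.assoc, Scheme.OpenCover.map_glueMorphismsOfLocallyDirected]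
    · exact Scheme.OpenCover.map_glueMorphismsOfLocallyDirected _ q hq i
  refine ⟨g, fun i ↦ ?_⟩
  apply Over.OverMorphism.ext
  rw [Over.comp_left, ← cancel_epi (whiskerPullbackIso Y (coverOverι 𝒱 i)).hom, ← Category.assoc,
    whiskerPullbackIso_hom_whiskerLeft]
  exact hg i

end

/-- A natural map between Hom sets that are sheaves in `T` is bijective over a given element as
soon as it is so over all affine schemes. -/
theorem existsUnique_of_affine {Y₁ Y₂ W₁ W₂ : Over S}
    (α : ∀ T : Over S, (Y₁ ⊗ T ⟶ W₁) → (Y₂ ⊗ T ⟶ W₂))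
    (hα : ∀ ⦃T' T : Over S⦄ (t : T' ⟶ T) (g : Y₁ ⊗ T ⟶ W₁), α T' (Y₁ ◁ t ≫ g) = Y₂ ◁ t ≫ α T g)
    (f : Y₂ ⊗ T ⟶ W₂)
    (h : ∀ U : Over S, IsAffine U.left → ∀ u : U ⟶ T, ∃! g, α U g = Y₂ ◁ u ≫ f) :
    ∃! g, α T g = f := by
  -- Overlaps of affine opens need not be affine; in a directed cover only inclusions between affine
  -- members have to be checked.
  let 𝒱 := T.left.directedAffineCover
  have ha (i : 𝒱.I₀) : IsAffine (coverOver 𝒱 i).left := i.2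
  choose g hg hgu using fun i ↦ h (coverOver 𝒱 i) (ha i) (coverOverι 𝒱 i)
  have hc ⦃i j : 𝒱.I₀⦄ (hij : i ⟶ j) : coverOverTrans 𝒱 hij ≫ coverOverι 𝒱 j = coverOverι 𝒱 i :=
    Over.OverMorphism.ext (Scheme.Cover.trans_map 𝒱 hij)
  -- Uniqueness over the smaller affine member forces the local solutions to be compatible.
  obtain ⟨x, hx⟩ := exists_glue_of_cover 𝒱 g fun i j hij ↦ hgu i _ (by
    change α _ _ = _
    rw [hα, hg, ← MonoidalCategory.whiskerLeft_comp_assoc, hc])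
  refine ⟨x, hom_ext_of_cover 𝒱 fun i ↦ ?_, fun y hy ↦ hom_ext_of_cover 𝒱 fun i ↦ ?_⟩
  · rw [← hα, hx]; exact hg i
  · rw [hx]
    exact hgu i _ (by change α _ _ = _; rw [hα, hy])

end Gluing

/-! ### Coequalizers with respect to affine targets, stable under products -/

section UniversalCoequalizer
variable {S : Scheme.{u}}

/-- `p : Y ⟶ Z` has the property of a coequalizer of `a, b : X ⟶ Y` with respect to morphisms to
affine schemes, and keeps it after products with arbitrary `S`-schemes. -/
structure IsUniversalCoequalizer {X Y Z : Over S} (a b : X ⟶ Y) (p : Y ⟶ Z) : Prop where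
  condition : a ≫ p = b ≫ p
  existsUnique : ∀ (T W : Over S), IsAffine W.left → ∀ f : Y ⊗ T ⟶ W,
    a ▷ T ≫ f = b ▷ T ≫ f → ∃! g : Z ⊗ T ⟶ W, p ▷ T ≫ g = f

/-- Morphisms out of `Y × T` and `Z × T` form sheaves in `T`, so unique factorization may be tested
over affine `T`. -/
theorem IsUniversalCoequalizer.of_affine {X Y Z : Over S} {a b : X ⟶ Y} {p : Y ⟶ Z}
    (w : a ≫ p = b ≫ p)
    (h : ∀ (T W : Over S), IsAffine T.left → IsAffine W.left → ∀ f : Y ⊗ T ⟶ W,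
      a ▷ T ≫ f = b ▷ T ≫ f → ∃! g : Z ⊗ T ⟶ W, p ▷ T ≫ g = f) :
    IsUniversalCoequalizer a b p where
  condition := w
  existsUnique T W hW f hf := existsUnique_of_affine (fun T g ↦ p ▷ T ≫ g)
    (fun T' T t g ↦ (whisker_exchange_assoc p t g).symm) f fun U hU t ↦ by
      apply h U W hU hW
      rw [← whisker_exchange_assoc, hf, whisker_exchange_assoc]

end UniversalCoequalizer

end

/-! ### Existence of affine coequalizers over a field -/

section

section AlgebraicEqualizer
open TensorProduct

/-- Since `R` is flat over `k`, tensoring with it commutes with the equalizer and keeps its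
inclusion injective: an equalizing map takes values in the image of the tensored equalizer, and
lifts uniquely. -/
theorem existsUnique_algHom_equalizer_tensor {k A B R D : Type*} [Field k]
    [CommRing A] [Algebra k A] [CommRing B] [Algebra k B] [CommRing R] [Algebra k R] [CommRing D] [Algebra k D]
    (α β : A →ₐ[k] B) (x : D →ₐ[k] A ⊗[k] R)
    (hx : (Algebra.TensorProduct.map α (.id k R)).comp x =
      (Algebra.TensorProduct.map β (.id k R)).comp x) :
    ∃! y : D →ₐ[k] AlgHom.equalizer α β ⊗[k] R,
      (Algebra.TensorProduct.map (AlgHom.equalizer α β).val (.id k R)).comp y = x := by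
  let E := AlgHom.equalizer α β
  let v : E ⊗[k] R →ₐ[k] A ⊗[k] R := Algebra.TensorProduct.map E.val (.id k R)
  have hv : Function.Injective v :=
    Module.Flat.rTensor_preserves_injective_linearMap (M := R) E.val.toLinearMap
      Subtype.val_injective
  -- `AlgHom.tensorEqualizerEquiv` has `R` as the left factor, so the factors have to be swapped.
  have hcomm (δ : A →ₐ[k] B) (z : A ⊗[k] R) :
      Algebra.TensorProduct.map (.id k R) δ (Algebra.TensorProduct.comm k A R z) =
        Algebra.TensorProduct.comm k B R (Algebra.TensorProduct.map δ (.id k R) z) := by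
    induction z with
    | zero => simp
    | add z w hz hw => simp [hz, hw]
    | tmul a r => simp
  have hr (d : D) : x d ∈ v.range := by
    have h1 : Algebra.TensorProduct.comm k A R (x d) ∈ AlgHom.equalizer
        (Algebra.TensorProduct.map (AlgHom.id k R) α)
        (Algebra.TensorProduct.map (AlgHom.id k R) β) := by
      change _ = _
      rw [hcomm, hcomm]
      exact congr_arg _ (DFunLike.congr_fun hx d)
    obtain ⟨w, hw⟩ := (AlgHom.tensorEqualizerEquiv k R α β).surjective ⟨_, h1⟩
    have hw' := congr_arg Subtype.val hw
    rw [AlgHom.tensorEqualizerEquiv_apply, AlgHom.coe_tensorEqualizer] at hw'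
    refine ⟨Algebra.TensorProduct.comm k R E w, ?_⟩
    apply (Algebra.TensorProduct.comm k A R).injective
    refine Eq.trans ?_ hw'
    change Algebra.TensorProduct.comm k A R (v (Algebra.TensorProduct.comm k R E w)) = _
    clear hw hw'
    induction w with
    | zero => simp
    | add z w hz hw => simpa using congr_arg₂ (· + ·) hz hw
    | tmul a r => simp [v]
  let e := AlgEquiv.ofInjective v hv
  refine ⟨e.symm.toAlgHom.comp (x.codRestrict v.range hr), ?_, fun y hy ↦ ?_⟩
  · ext d
    exact congr_arg Subtype.val (e.apply_symm_apply ⟨x d, hr d⟩)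
  · ext d
    apply hv
    refine (DFunLike.congr_fun hy d).trans ?_
    exact (congr_arg Subtype.val (e.apply_symm_apply ⟨x d, hr d⟩)).symm

end AlgebraicEqualizer

section Existence
variable {k : Type u} [Field k]

variable (k) in
/-- `Spec` as a functor from `k`-algebras to `k`-schemes. -/
abbrev specFunctor : (CommAlgCat.{u} k)ᵒᵖ ⥤ Over (Spec (.of k)) := algSpec (.of k)

instance : (specFunctor k).Monoidal := (braidedAlgSpec (R := .of k)).toMonoidal

instance : (specFunctor k).Full := algSpec.instFull (R := .of k)

instance : (specFunctor k).Faithful := algSpec.instFaithful (R := .of k)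

theorem exists_iso_algSpec {R : CommRingCat.{u}} {X : Over (Spec R)} (hX : IsAffine X.left) :
    ∃ A : (CommAlgCat R)ᵒᵖ, Nonempty ((algSpec R).obj A ≅ X) :=
  essImage_algSpec.2 hX

open Functor in
-- `Spec` is fully faithful and takes tensor products to products, so for affine `T` and `W` the
-- claim is the algebraic one read backwards.
theorem existsUnique_algSpec_equalizer {A B : CommAlgCat.{u} k}
    (α β : A ⟶ B) (T W : Over (Spec (.of k))) (hT : IsAffine T.left) (hW : IsAffine W.left)
    (f : (specFunctor k).obj (op A) ⊗ T ⟶ W)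
    (hf : (specFunctor k).map α.op ▷ T ≫ f = (specFunctor k).map β.op ▷ T ≫ f) :
    ∃! g, (specFunctor k).map
      (CommAlgCat.ofHom (AlgHom.equalizer α.hom β.hom).val).op ▷ T ≫ g = f := by
  obtain ⟨R, ⟨eR⟩⟩ := exists_iso_algSpec hT
  obtain ⟨D, ⟨eD⟩⟩ := exists_iso_algSpec hW
  let hF : (specFunctor k).FullyFaithful := algSpec.fullyFaithful
  -- Maps from `Spec P × T` to `W` as algebra maps `D → P ⊗ R`; `hθ` is naturality in `P`.
  let θ (P : (CommAlgCat.{u} k)ᵒᵖ) : ((specFunctor k).obj P ⊗ T ⟶ W) ≃ (P ⊗ R ⟶ D) :=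
    ((Iso.homCongr ((whiskerLeftIso ((specFunctor k).obj P) eR).symm ≪≫
      Monoidal.μIso (specFunctor k) P R) eD.symm).trans
      hF.homEquiv.symm)
  have hθ {P Q : (CommAlgCat.{u} k)ᵒᵖ} (q : P ⟶ Q) (g : (specFunctor k).obj Q ⊗ T ⟶ W) :
      θ P ((specFunctor k).map q ▷ T ≫ g) = q ▷ R ≫ θ Q g := by
    apply hF.map_injective
    rw [(specFunctor k).map_comp, Functor.Monoidal.map_whiskerRight]
    have h (P) (g : (specFunctor k).obj P ⊗ T ⟶ W) : (specFunctor k).map (θ P g) =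
      OplaxMonoidal.δ (specFunctor k) P R ≫ (specFunctor k).obj P ◁ eR.hom ≫ g ≫ eD.inv := by
      refine (hF.map_preimage _).trans ?_
      simp
    simp [h, whisker_exchange_assoc]
  obtain ⟨y, hy, hyu⟩ := existsUnique_algHom_equalizer_tensor α.hom β.hom (θ _ f).unop.hom (by
    have := congr_arg (θ _) hf
    rw [hθ, hθ] at this
    exact congr_arg (fun q ↦ q.unop.hom) this)
  let P := CommAlgCat.of k (AlgHom.equalizer α.hom β.hom)
  let p : op A ⟶ op P := (CommAlgCat.ofHom (AlgHom.equalizer α.hom β.hom).val).op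
  refine ⟨(θ (op P)).symm (CommAlgCat.ofHom y).op, ?_, fun g hg ↦ ?_⟩
  · apply (θ _).injective
    change θ _ ((specFunctor k).map p ▷ T ≫ _) = _
    rw [hθ, Equiv.apply_symm_apply]
    apply Quiver.Hom.unop_inj
    ext1
    exact hy
  · rw [Equiv.eq_symm_apply]
    apply Quiver.Hom.unop_inj
    ext1
    apply hyu
    have := congr_arg (θ _) hg
    change θ _ ((specFunctor k).map p ▷ T ≫ _) = _ at this
    rw [hθ] at this
    exact congr_arg (fun q ↦ q.unop.hom) this

/-- `Z` is the spectrum of the equalizer of the two maps on coordinate rings. -/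
theorem exists_isUniversalCoequalizer {X Y : Over (Spec (.of k))} (hX : IsAffine X.left)
    (hY : IsAffine Y.left) (a b : X ⟶ Y) :
    ∃ (Z : Over (Spec (.of k))) (p : Y ⟶ Z), IsAffine Z.left ∧ (IsFinite Y.hom → IsFinite Z.hom) ∧
      IsUniversalCoequalizer a b p := by
  obtain ⟨⟨B⟩, ⟨eB⟩⟩ := exists_iso_algSpec hX
  obtain ⟨⟨A⟩, ⟨eA⟩⟩ := exists_iso_algSpec hY
  let hF : (specFunctor k).FullyFaithful := algSpec.fullyFaithful
  obtain ⟨α, hα⟩ := (specFunctor k).map_surjective (eB.hom ≫ a ≫ eA.inv)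
  obtain ⟨β, hβ⟩ := (specFunctor k).map_surjective (eB.hom ≫ b ≫ eA.inv)
  let E := CommAlgCat.of k (AlgHom.equalizer α.unop.hom β.unop.hom)
  let p : op A ⟶ op E := (CommAlgCat.ofHom (AlgHom.equalizer α.unop.hom β.unop.hom).val).op
  have ha : a = eB.inv ≫ (specFunctor k).map α ≫ eA.hom := by simp [hα]
  have hb : b = eB.inv ≫ (specFunctor k).map β ≫ eA.hom := by simp [hβ]
  refine ⟨(specFunctor k).obj (op E), eA.inv ≫ (specFunctor k).map p,
    essImage_algSpec.1 ⟨_, ⟨Iso.refl _⟩⟩, fun h ↦ ?_, .of_affine ?_ fun T W hT hW f hf ↦ ?_⟩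
  · have h1 : IsFinite ((specFunctor k).obj (op A)).hom := by
      rw [← Over.w eA.hom]
      have : IsIso eA.hom.left := inferInstanceAs (IsIso ((Over.forget _).map eA.hom))
      exact MorphismProperty.comp_mem @IsFinite eA.hom.left Y.hom inferInstance h
    change IsFinite (Spec.map (CommRingCat.ofHom (algebraMap k A))) at h1
    change IsFinite (Spec.map (CommRingCat.ofHom (algebraMap k E)))
    rw [IsFinite.SpecMap_iff] at h1 ⊢
    have : Module.Finite k A := RingHom.finite_algebraMap.1 h1
    -- A subspace of a finite-dimensional vector space.
    have : Module.Finite k E := Module.Finite.of_injective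
      (AlgHom.equalizer α.unop.hom β.unop.hom).val.toLinearMap Subtype.val_injective
    exact RingHom.finite_algebraMap.2 this
  · rw [ha, hb]
    simp only [Category.assoc, Iso.hom_inv_id_assoc, ← (specFunctor k).map_comp]
    congr 2
    apply Quiver.Hom.unop_inj
    ext x
    exact x.2
  · obtain ⟨g, hg, hgu⟩ := existsUnique_algSpec_equalizer α.unop β.unop T W hT hW
      (eA.hom ▷ T ≫ f) (by
        rw [← cancel_epi (eB.inv ▷ T)]
        simpa [ha, hb] using hf)
    refine ⟨g, ?_, fun g' hg' ↦ hgu g' ?_⟩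
    · change ((specFunctor k).map p ▷ T) ≫ g = _ at hg
      rw [comp_whiskerRight, Category.assoc, hg]
      simp
    · change ((specFunctor k).map p ▷ T) ≫ g' = _
      simp [← hg']

end Existence

end

/-! ### Cancellation of quotient maps and descent of homomorphisms -/

section

section AffineEpi
variable {S : Scheme.{u}}

/-- `p` is an epimorphism with respect to morphisms to affine schemes, also after products with
arbitrary `S`-schemes. -/
def IsUniversalAffineEpi {Y Z : Over S} (p : Y ⟶ Z) : Prop :=
  ∀ ⦃T W : Over S⦄, IsAffine W.left → ∀ ⦃u v : Z ⊗ T ⟶ W⦄, p ▷ T ≫ u = p ▷ T ≫ v → u = v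

variable {X Y Z Z' : Over S}

theorem IsUniversalCoequalizer.isUniversalAffineEpi {a b : X ⟶ Y} {p : Y ⟶ Z}
    (h : IsUniversalCoequalizer a b p) : IsUniversalAffineEpi p := by
  intro T W hW u v huv
  refine (h.existsUnique T W hW (p ▷ T ≫ v) ?_).unique huv rfl
  rw [← comp_whiskerRight_assoc, h.condition, comp_whiskerRight_assoc]

theorem IsUniversalCoequalizer.existsUnique_desc {a b : X ⟶ Y} {p : Y ⟶ Z}
    (h : IsUniversalCoequalizer a b p) {W : Over S} (hW : IsAffine W.left) (f : Y ⟶ W)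
    (hf : a ≫ f = b ≫ f) : ∃ g : Z ⟶ W, p ≫ g = f := by
  obtain ⟨g, hg, -⟩ := h.existsUnique (𝟙_ _) W hW ((ρ_ Y).hom ≫ f) (by
    rw [rightUnitor_naturality_assoc, hf, rightUnitor_naturality_assoc])
  refine ⟨(ρ_ Z).inv ≫ g, ?_⟩
  rw [rightUnitor_inv_naturality_assoc, hg, Iso.inv_hom_id_assoc]

theorem IsUniversalAffineEpi.hom_ext {p : Y ⟶ Z} (h : IsUniversalAffineEpi p) {W : Over S}
    (hW : IsAffine W.left) {u v : Z ⟶ W} (huv : p ≫ u = p ≫ v) : u = v := by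
  have := h (T := 𝟙_ _) hW (u := (ρ_ Z).hom ≫ u) (v := (ρ_ Z).hom ≫ v) (by
    rw [rightUnitor_naturality_assoc, huv, rightUnitor_naturality_assoc])
  simpa using this

theorem IsUniversalAffineEpi.comp {p : Y ⟶ Z} {q : X ⟶ Y} (hp : IsUniversalAffineEpi p)
    (hq : IsUniversalAffineEpi q) : IsUniversalAffineEpi (q ≫ p) := by
  intro T W hW u v huv
  rw [comp_whiskerRight_assoc, comp_whiskerRight_assoc] at huv
  exact hp hW (hq hW huv)

theorem IsUniversalAffineEpi.of_iso (e : Y ≅ Z) : IsUniversalAffineEpi e.hom := by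
  intro T W hW u v huv
  rwa [cancel_epi] at huv

/-- The extra factor `X` is absorbed into the test scheme `T` by associativity; this is what
quantifying over all `T` buys. -/
theorem IsUniversalAffineEpi.whiskerRight {p : Y ⟶ Z} (hp : IsUniversalAffineEpi p) (X : Over S) :
    IsUniversalAffineEpi (p ▷ X) := by
  intro T W hW u v huv
  have := hp (T := X ⊗ T) hW (u := (α_ Z X T).inv ≫ u) (v := (α_ Z X T).inv ≫ v) (by
    rw [← cancel_epi (α_ Y X T).hom]
    simpa using huv)
  simpa using this

theorem IsUniversalAffineEpi.whiskerLeft {p : Y ⟶ Z} (hp : IsUniversalAffineEpi p) (X : Over S) :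
    IsUniversalAffineEpi (X ◁ p) := by
  have h : X ◁ p = (β_ X Y).hom ≫ p ▷ X ≫ (β_ Z X).hom := by simp
  rw [h]
  exact ((IsUniversalAffineEpi.of_iso _).comp (hp.whiskerRight X)).comp (.of_iso _)

theorem IsUniversalAffineEpi.tensorHom {p : Y ⟶ Z} (hp : IsUniversalAffineEpi p) {X X' : Over S}
    {q : X ⟶ X'} (hq : IsUniversalAffineEpi q) : IsUniversalAffineEpi (p ⊗ₘ q) := by
  rw [MonoidalCategory.tensorHom_def]
  exact (hq.whiskerLeft _).comp (hp.whiskerRight _)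

end AffineEpi

section HomFamily
variable {C : Type*} [Category* C] [CartesianMonoidalCategory C]

/-- Yoneda: the condition need only be checked at the universal point of `(G × G) × T`. -/
theorem isHomFamily_iff {G H T : C} [MonObj G] [MonObj H] (f : G ⊗ T ⟶ H) :
    IsHomFamily f ↔
      lift ((fst (G ⊗ G) T ≫ fst G G) * (fst (G ⊗ G) T ≫ snd G G)) (snd (G ⊗ G) T) ≫ f =
        (lift (fst (G ⊗ G) T ≫ fst G G) (snd (G ⊗ G) T) ≫ f) *
          (lift (fst (G ⊗ G) T ≫ snd G G) (snd (G ⊗ G) T) ≫ f) := by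
  refine ⟨fun h ↦ h _ _ _, fun h Y x y t ↦ ?_⟩
  have := congr_arg (lift (lift x y) t ≫ ·) h
  simpa [MonObj.comp_mul, comp_lift_assoc] using this

end HomFamily

variable {S : Scheme.{u}}

/-- The universal identity lives on `(Z × Z) × T` and may be tested after `(p × p) × T`, where it
becomes the identity for `G`. -/
theorem IsUniversalAffineEpi.isHomFamily {G Z H T : Over S} [MonObj G] [MonObj Z] [MonObj H]
    {p : G ⟶ Z} [IsMonHom p] (hp : IsUniversalAffineEpi p) (hH : IsAffine H.left)
    {g : Z ⊗ T ⟶ H} (hg : IsHomFamily (p ▷ T ≫ g)) : IsHomFamily g := by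
  rw [isHomFamily_iff]
  apply hp.tensorHom hp hH
  have e {Y : Over S} (x : Y ⟶ G) (t : Y ⟶ T) : lift (x ≫ p) t ≫ g = lift x t ≫ p ▷ T ≫ g := by
    simp
  simp only [MonObj.comp_mul, comp_lift_assoc, whiskerRight_fst_assoc, tensorHom_fst,
    tensorHom_snd, whiskerRight_snd]
  simp only [← Category.assoc _ _ p, ← MonObj.mul_comp]
  rw [e, e, e]
  exact hg _ _ _

theorem existsUnique_homOver_precomp {X : Over S} {G Z H : CommGrp (Over S)} {a b : X ⟶ G.X}
    (π : G ⟶ Z)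
    (h : IsUniversalCoequalizer a b π.hom.hom.hom) (hH : IsAffine H.X.left) {T : Over S}
    (φ : HomOver G H T) (hφ : a ▷ T ≫ toFamily φ = b ▷ T ≫ toFamily φ) :
    ∃! χ : HomOver Z H T, ((baseChange T).map π).hom ≫ χ = φ := by
  obtain ⟨g, hg, hgu⟩ := h.existsUnique T H.X hH _ hφ
  obtain ⟨χ, rfl⟩ := exists_toFamily_eq (h.isUniversalAffineEpi.isHomFamily (p := π.hom.hom.hom) hH
    (hg ▸ isHomFamily_toFamily φ))
  refine ⟨χ, toFamily_injective ((toFamily_precomp _ _).trans hg), fun χ' h' ↦ ?_⟩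
  apply toFamily_injective
  apply hgu
  rw [← toFamily_precomp, h']

/-! ### Group structure on the quotient -/

section Quotient

/-- The action of `N` on `G` by translation along `f`. -/
def translate {C : Type*} [Category* C] [CartesianMonoidalCategory C] {N G : C} [MonObj G]
    (f : N ⟶ G) : N ⊗ G ⟶ G :=
  (fst N G ≫ f) * snd N G

theorem lift_translate {C : Type*} [Category* C] [CartesianMonoidalCategory C] {N G Y : C}
    [MonObj G] (f : N ⟶ G) (n : Y ⟶ N) (x : Y ⟶ G) : lift n x ≫ translate f = (n ≫ f) * x := by
  simp [translate, MonObj.comp_mul]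

/-- Each axiom for `Z` becomes the axiom for `G` after composition with a product of copies of `p`.
Cancellation is required only for maps to `Z` from the sources of the axioms, because `p` will be
known to be epi only against affine targets. -/
theorem exists_grpObj_of_cancel {C : Type*} [Category* C] [CartesianMonoidalCategory C]
    [BraidedCategory C] {G Z : C} [GrpObj G] [IsCommMonObj G] (p : G ⟶ Z) (m : Z ⊗ Z ⟶ Z)
    (i : Z ⟶ Z) (hm : ∀ ⦃Y : C⦄ (x y : Y ⟶ G), lift (x ≫ p) (y ≫ p) ≫ m = (x * y) ≫ p)
    (hi : p ≫ i = (𝟙 G)⁻¹ ≫ p)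
    (h₁ : ∀ u v : Z ⟶ Z, p ≫ u = p ≫ v → u = v)
    (h₂ : ∀ u v : Z ⊗ Z ⟶ Z, (p ⊗ₘ p) ≫ u = (p ⊗ₘ p) ≫ v → u = v)
    (h₃ : ∀ u v : (Z ⊗ Z) ⊗ Z ⟶ Z, ((p ⊗ₘ p) ⊗ₘ p) ≫ u = ((p ⊗ₘ p) ⊗ₘ p) ≫ v → u = v)
    (hl : ∀ u v : 𝟙_ C ⊗ Z ⟶ Z, 𝟙_ C ◁ p ≫ u = 𝟙_ C ◁ p ≫ v → u = v)
    (hr : ∀ u v : Z ⊗ 𝟙_ C ⟶ Z, p ▷ 𝟙_ C ≫ u = p ▷ 𝟙_ C ≫ v → u = v) :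
    ∃ (_ : GrpObj Z) (_ : IsCommMonObj Z), IsMonHom p := by
  let M : MonObj Z :=
    { one := η ≫ p
      mul := m
      one_mul := by
        apply hl
        have e : 𝟙_ _ ◁ p ≫ (η[G] ≫ p) ▷ Z = lift ((fst _ _ ≫ η) ≫ p) (snd _ _ ≫ p) := by
          apply CartesianMonoidalCategory.hom_ext <;>
            simp [leftUnitor_hom, toUnit_unique (toUnit _) (fst _ _)]
        rw [← Category.assoc, e, hm, MonObj.one_eq_one, MonObj.comp_one, one_mul, leftUnitor_hom,
          whiskerLeft_snd]
      mul_one := by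
        apply hr
        have e : p ▷ 𝟙_ _ ≫ Z ◁ (η[G] ≫ p) = lift (fst _ _ ≫ p) ((snd _ _ ≫ η) ≫ p) := by
          apply CartesianMonoidalCategory.hom_ext <;>
            simp [rightUnitor_hom, toUnit_unique (toUnit _) (snd _ _)]
        rw [← Category.assoc, e, hm, MonObj.one_eq_one, MonObj.comp_one, mul_one, rightUnitor_hom,
          whiskerRight_fst]
      mul_assoc := by
        apply h₃
        have e0 : (p ⊗ₘ p) ≫ m = (fst _ _ * snd _ _) ≫ p := by
          rw [← hm]
          congr 1
          ext <;> simp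
        have e1 : ((p ⊗ₘ p) ⊗ₘ p) ≫ m ▷ Z =
            lift ((fst _ _ ≫ (fst _ _ * snd _ _)) ≫ p) (snd _ _ ≫ p) := by
          apply CartesianMonoidalCategory.hom_ext
          · rw [Category.assoc, whiskerRight_fst, tensorHom_fst_assoc, e0, lift_fst, Category.assoc]
          · simp only [Category.assoc, whiskerRight_snd, tensorHom_snd, lift_snd]
        have e2 : (((p ⊗ₘ p) ⊗ₘ p) ≫ (α_ _ _ _).hom) ≫ Z ◁ m =
            lift ((fst _ _ ≫ fst _ _) ≫ p)
              ((lift (fst _ _ ≫ snd _ _) (snd _ _) ≫ (fst _ _ * snd _ _)) ≫ p) := by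
          rw [associator_naturality, Category.assoc, ← id_tensorHom, tensorHom_comp_tensorHom, e0]
          ext
          · simp
          · simp only [Category.assoc, tensorHom_snd, lift_snd, MonObj.comp_mul]
            simp only [← Category.assoc, MonObj.comp_mul]
            simp
        rw [← Category.assoc, e1, ← Category.assoc, ← Category.assoc, e2, hm, hm]
        simp [MonObj.comp_mul, mul_assoc] }
  let Gr : GrpObj Z :=
    { inv := i
      left_inv := by
        apply h₁
        have e : p ≫ lift i (𝟙 Z) = lift ((𝟙 G)⁻¹ ≫ p) (𝟙 G ≫ p) := by
          ext <;> simp [← hi]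
        rw [← Category.assoc, e]
        refine (hm _ _).trans ?_
        rw [inv_mul_cancel, Hom.one_def, comp_toUnit_assoc, Category.assoc]
        rfl
      right_inv := by
        apply h₁
        have e : p ≫ lift (𝟙 Z) i = lift (𝟙 G ≫ p) ((𝟙 G)⁻¹ ≫ p) := by
          ext <;> simp [← hi]
        rw [← Category.assoc, e]
        refine (hm _ _).trans ?_
        rw [mul_inv_cancel, Hom.one_def, comp_toUnit_assoc, Category.assoc]
        rfl }
  refine ⟨Gr, ⟨?_⟩, isMonHom_of_comp_mul p fun Y x y ↦ (hm x y).symm⟩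
  apply h₂
  have e1 : (p ⊗ₘ p) ≫ (β_ Z Z).hom = lift (snd _ _ ≫ p) (fst _ _ ≫ p) := by
    ext <;> simp
  have e2 : (p ⊗ₘ p) = lift (fst _ _ ≫ p) (snd _ _ ≫ p) := by
    ext <;> simp
  rw [← Category.assoc, e1, e2]
  refine (hm _ _).trans (Eq.trans ?_ (hm _ _).symm)
  rw [mul_comm]

variable {N G Z : Over S} [GrpObj N] [GrpObj G] [IsCommMonObj G] {f g : N ⟶ G}
  {p : G ⟶ Z} (h : IsUniversalCoequalizer (translate f) (translate g) p)

include h in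
omit [GrpObj N] [IsCommMonObj G] in
theorem IsUniversalCoequalizer.mul_comp_eq {Y : Over S} (n : Y ⟶ N) (x : Y ⟶ G) :
    ((n ≫ f) * x) ≫ p = ((n ≫ g) * x) ≫ p := by
  rw [← lift_translate, ← lift_translate, Category.assoc, h.condition, Category.assoc]

variable (hZ : IsAffine Z.left)

include h hZ in
omit [GrpObj N] in
-- The product of `G` descends in one variable at a time: in the first by associativity, in the
-- second by commutativity, which moves the translation to the front.
theorem IsUniversalCoequalizer.exists_mul : ∃ m : Z ⊗ Z ⟶ Z, ∀ ⦃Y : Over S⦄ (x y : Y ⟶ G),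
    lift (x ≫ p) (y ≫ p) ≫ m = (x * y) ≫ p := by
  have e (q : N ⊗ G ⟶ G) : q ▷ G ≫ μ = (fst _ _ ≫ q) * snd _ _ := by
    rw [Hom.mul_def]
    congr 1
  have e' (f : N ⟶ G) : fst _ G ≫ translate f = ((fst _ _ ≫ fst _ _) ≫ f) * (fst _ _ ≫ snd _ _) := by
    rw [translate, MonObj.comp_mul, Category.assoc]
  obtain ⟨m₁, hm₁, -⟩ := h.existsUnique G Z hZ (μ[G] ≫ p) (by
    rw [reassoc_of% e, reassoc_of% e, e', e', mul_assoc, mul_assoc, h.mul_comp_eq])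
  have hm₁' ⦃Y : Over S⦄ (x y : Y ⟶ G) : lift (x ≫ p) y ≫ m₁ = (x * y) ≫ p := by
    rw [Hom.mul_def, Category.assoc, ← hm₁]
    simp
  have e'' (q : N ⊗ G ⟶ G) : (N ⊗ G) ◁ p ≫ q ▷ Z ≫ (β_ G Z).hom =
      lift (snd _ _ ≫ p) (fst _ _ ≫ q) := by
    apply CartesianMonoidalCategory.hom_ext <;> simp only [Category.assoc, braiding_hom_fst,
      braiding_hom_snd, lift_fst, lift_snd, whiskerRight_fst, whiskerRight_snd, whiskerLeft_fst_assoc,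
      whiskerLeft_snd]
  obtain ⟨m, hm, -⟩ := h.existsUnique Z Z hZ ((β_ G Z).hom ≫ m₁) (by
    -- The map `m₁` is computable only on points of `Z` that come from `G`, so the `Z`-coordinate is
    -- first pulled back along `p`.
    apply h.isUniversalAffineEpi.whiskerLeft _ |>.hom_ext hZ
    rw [reassoc_of% e'', reassoc_of% e'', hm₁', hm₁', e', e', mul_left_comm, h.mul_comp_eq,
      mul_left_comm])
  refine ⟨(β_ Z Z).hom ≫ m, fun Y x y ↦ ?_⟩
  have : lift (x ≫ p) (y ≫ p) ≫ (β_ Z Z).hom = lift y (x ≫ p) ≫ p ▷ Z := by ext <;> simp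
  rw [reassoc_of% this, hm, ← hm₁']
  simp

include h hZ in
-- By commutativity the inverse of `f(n) x` is `f(n⁻¹) x⁻¹`, again a translate, so inversion
-- followed by `p` coequalizes the translations.
theorem IsUniversalCoequalizer.exists_inv [IsMonHom f] [IsMonHom g] :
    ∃ i : Z ⟶ Z, ∀ ⦃Y : Over S⦄ (x : Y ⟶ G), x ≫ p ≫ i = x⁻¹ ≫ p := by
  have e (f : N ⟶ G) [IsMonHom f] :
      translate f ≫ ι = ((fst _ _)⁻¹ ≫ f) * (snd _ _)⁻¹ := by
    rw [← Hom.inv_def, translate, mul_inv, GrpObj.inv_comp]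
  obtain ⟨i, hi⟩ := h.existsUnique_desc hZ (ι[G] ≫ p) (by
    rw [reassoc_of% e, reassoc_of% e, h.mul_comp_eq])
  exact ⟨i, fun Y x ↦ by rw [hi, Hom.inv_def, Category.assoc]⟩

include h hZ in
theorem IsUniversalCoequalizer.exists_grpObj [IsMonHom f] [IsMonHom g] :
    ∃ (_ : GrpObj Z) (_ : IsCommMonObj Z), IsMonHom p := by
  obtain ⟨m, hm⟩ := h.exists_mul hZ
  obtain ⟨i, hi⟩ := h.exists_inv hZ
  have hp := h.isUniversalAffineEpi
  refine exists_grpObj_of_cancel p m i hm (by rw [← hi, Category.id_comp])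
    (fun _ _ ↦ hp.hom_ext hZ) (fun _ _ ↦ (hp.tensorHom hp).hom_ext hZ)
    (fun _ _ ↦ ((hp.tensorHom hp).tensorHom hp).hom_ext hZ)
    (fun _ _ ↦ (hp.whiskerLeft _).hom_ext hZ) (fun _ _ ↦ (hp.whiskerRight _).hom_ext hZ)

/-- The coequalizer of two homomorphisms, obtained as a scheme from the two translation actions.
Flatness of the quotient map is neither proved nor needed. -/
theorem exists_quotient {k : Type u} [Field k] {N G : CommGrp (Over (Spec (.of k)))}
    (hN : IsAffine N.X.left) (hG : IsAffine G.X.left) (f g : N ⟶ G) :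
    ∃ (Z : CommGrp (Over (Spec (.of k)))) (π : G ⟶ Z), IsAffine Z.X.left ∧
      (IsFinite G.X.hom → IsFinite Z.X.hom) ∧
      IsUniversalCoequalizer (translate f.hom.hom.hom) (translate g.hom.hom.hom)
        π.hom.hom.hom := by
  have hNG : IsAffine (N.X ⊗ G.X).left := inferInstanceAs (IsAffine (pullback N.X.hom G.X.hom))
  obtain ⟨Z, p, hZ, hfin, h⟩ := exists_isUniversalCoequalizer hNG hG
    (translate f.hom.hom.hom) (translate g.hom.hom.hom)
  obtain ⟨_, _, _⟩ := h.exists_grpObj hZ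
  exact ⟨⟨Z⟩, InducedCategory.homMk (Grp.ofHom p), hZ, hfin, h⟩

end Quotient

/-! ### Faithfully flat quotients -/

section ShortExact
variable {k : Type u} [Field k]

/-- For affine `T` the base change of `π` is a faithfully flat map of affine schemes, hence a
regular epimorphism. Its kernel pair is governed by `N`: points `x`, `y` of `G` with the same image
satisfy `x = n y` with `n` in the kernel, so a map invariant under translation descends. -/
theorem isUniversalCoequalizer_of_isShortExact {N G Q : CommGrp (Over (Spec (.of k)))}
    {i : N ⟶ G} {π : G ⟶ Q} (h : IsShortExact i π) (hG : IsAffine G.X.left)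
    (hQ : IsAffine Q.X.left) :
    IsUniversalCoequalizer (translate i.hom.hom.hom) (snd N.X G.X) π.hom.hom.hom := by
  have hi : i.hom.hom.hom ≫ π.hom.hom.hom = 1 := h.isKernel.w
  refine .of_affine ?_ fun T W hT hW f hf ↦ ?_
  · rw [translate, MonObj.mul_comp, Category.assoc, hi, MonObj.comp_one, one_mul]
  have h1 : IsAffine (G.X ⊗ T).left := inferInstanceAs (IsAffine (pullback G.X.hom T.hom))
  have h2 : IsAffine (Q.X ⊗ T).left := inferInstanceAs (IsAffine (pullback Q.X.hom T.hom))
  let q : (G.X ⊗ T).left ⟶ (Q.X ⊗ T).left := (π.hom.hom.hom ▷ T).left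
  have h3 : Flat q := MorphismProperty.pullbackMap (P := @Flat) h.flat
    (inferInstanceAs (Flat (𝟙 T.left))) (Over.w π.hom.hom.hom).symm (Category.id_comp _).symm
  have hs : MorphismProperty.IsStableUnderComposition @Surjective :=
    ⟨fun f g (_ : Surjective f) (_ : Surjective g) ↦ inferInstanceAs (Surjective (f ≫ g))⟩
  have h4 : Surjective q := MorphismProperty.pullbackMap (P := @Surjective) h.surjective
    (inferInstanceAs (Surjective (𝟙 T.left))) (Over.w π.hom.hom.hom).symm (Category.id_comp _).symm
  have h5 : IsRegularEpi q := isRegularEpi_of_flat_of_surjective_of_isAffine q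
  have h6 : Epi (π.hom.hom.hom ▷ T) := Over.epi_of_epi_left (hk := inferInstanceAs (Epi q))
  have key {Y : Over (Spec (.of k))} (u v : Y ⟶ G.X ⊗ T)
      (huv : u ≫ π.hom.hom.hom ▷ T = v ≫ π.hom.hom.hom ▷ T) : u ≫ f = v ≫ f := by
    have hx : (u ≫ fst _ _) ≫ π.hom.hom.hom = (v ≫ fst _ _) ≫ π.hom.hom.hom := by
      simpa using huv =≫ fst _ _
    have ht : u ≫ snd _ _ = v ≫ snd _ _ := by simpa using huv =≫ snd _ _
    let n : Y ⟶ N.X := h.isKernel.lift ((u ≫ fst _ _) * (v ≫ fst _ _)⁻¹) (toUnit _) (by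
      rw [MonObj.mul_comp, GrpObj.inv_comp, hx, mul_inv_cancel]; rfl)
    have hn : n ≫ i.hom.hom.hom = (u ≫ fst _ _) * (v ≫ fst _ _)⁻¹ := h.isKernel.lift_fst _ _ _
    have hu : lift (lift n (v ≫ fst _ _)) (v ≫ snd _ _) ≫ translate i.hom.hom.hom ▷ T = u := by
      apply CartesianMonoidalCategory.hom_ext
      · rw [Category.assoc, whiskerRight_fst, lift_fst_assoc, lift_translate, hn,
          inv_mul_cancel_right]
      · rw [Category.assoc, whiskerRight_snd, lift_snd, ht]
    have hv : lift (lift n (v ≫ fst _ _)) (v ≫ snd _ _) ≫ snd N.X G.X ▷ T = v := by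
      apply CartesianMonoidalCategory.hom_ext <;> simp
    rw [← hu, Category.assoc, hf, ← Category.assoc, hv]
  -- The kernel pair is formed in schemes; it is made a `k`-scheme so that `key` applies to its two
  -- projections.
  have hw : pullback.fst q q ≫ f.left = pullback.snd q q ≫ f.left := by
    let P : Over (Spec (.of k)) := Over.mk (pullback.fst q q ≫ (G.X ⊗ T).hom)
    let u : P ⟶ G.X ⊗ T := Over.homMk (pullback.fst q q) rfl
    let v : P ⟶ G.X ⊗ T := Over.homMk (pullback.snd q q) (by
      change _ = pullback.fst q q ≫ (G.X ⊗ T).hom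
      rw [← Over.w (π.hom.hom.hom ▷ T)]
      exact (pullback.condition_assoc _).symm)
    exact congr_arg CommaMorphism.left (key u v (Over.OverMorphism.ext pullback.condition))
  obtain ⟨g, hg⟩ := IsRegularEpi.exists_of_isKernelPair q (IsPullback.of_hasPullback q q) f.left hw
  refine ⟨Over.homMk g ?_, Over.OverMorphism.ext hg, fun g' hg' ↦ ?_⟩
  · rw [← cancel_epi q, reassoc_of% hg, Over.w]
    exact (Over.w (π.hom.hom.hom ▷ T)).symm
  · rw [← cancel_epi (π.hom.hom.hom ▷ T), hg']
    exact (Over.OverMorphism.ext hg).symm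

end ShortExact

end

/-! ### Products and pushouts of affine groups -/

section

section HomFamily
variable {C : Type*} [Category* C] [CartesianMonoidalCategory C]

theorem IsHomFamily.mul_whiskerRight {X G H T : C} [MonObj G] [MonObj H] {F : G ⊗ T ⟶ H}
    (hF : IsHomFamily F) (x y : X ⟶ G) :
    (x * y) ▷ T ≫ F = (x ▷ T ≫ F) * (y ▷ T ≫ F) := by
  have e (z : X ⟶ G) : z ▷ T = lift (fst X T ≫ z) (snd X T) := by
    apply CartesianMonoidalCategory.hom_ext <;> simp
  rw [e, e, e, MonObj.comp_mul, hF]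

theorem IsHomFamily.one_whiskerRight {X G H T : C} [MonObj G] [GrpObj H] {F : G ⊗ T ⟶ H}
    (hF : IsHomFamily F) : (1 : X ⟶ G) ▷ T ≫ F = 1 := by
  have := hF.mul_whiskerRight (1 : X ⟶ G) 1
  rwa [mul_one, left_eq_mul] at this

/-- On a multiplicative family, `F(f(n) x) = F(f(n)) F(x)`; compatibility with translations thereby
reduces to a condition on the restriction of `F` to `N`. -/
theorem IsHomFamily.translate_whiskerRight {N G H T : C} [MonObj G] [MonObj H] {F : G ⊗ T ⟶ H}
    (hF : IsHomFamily F) (f : N ⟶ G) :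
    translate f ▷ T ≫ F = (fst N G ▷ T ≫ f ▷ T ≫ F) * (snd N G ▷ T ≫ F) := by
  rw [translate, hF.mul_whiskerRight, comp_whiskerRight, Category.assoc]

end HomFamily

section Product
variable {C : Type*} [Category* C] [CartesianMonoidalCategory C]

theorem fst_comp_mul_snd_comp (G G' : C) [MonObj G] [MonObj G'] [BraidedCategory C] :
    (fst G G' ≫ lift (𝟙 G) (1 : G ⟶ G')) * (snd G G' ≫ lift (1 : G' ⟶ G) (𝟙 G')) =
      𝟙 (G ⊗ G') := by
  apply CartesianMonoidalCategory.hom_ext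
  · rw [MonObj.mul_comp, Category.assoc, Category.assoc, lift_fst, lift_fst, MonObj.comp_one,
      mul_one, Category.comp_id, Category.id_comp]
  · rw [MonObj.mul_comp, Category.assoc, Category.assoc, lift_snd, lift_snd, MonObj.comp_one,
      one_mul, Category.comp_id, Category.id_comp]

variable [BraidedCategory C]

instance (G G' : C) [MonObj G] [MonObj G'] : IsMonHom (lift (𝟙 G) (1 : G ⟶ G')) :=
  have : IsMonHom (1 : G ⟶ G') := inferInstanceAs (IsMonHom (toUnit _ ≫ η))
  inferInstance

instance (G G' : C) [MonObj G] [MonObj G'] : IsMonHom (lift (1 : G' ⟶ G) (𝟙 G')) :=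
  have : IsMonHom (1 : G' ⟶ G) := inferInstanceAs (IsMonHom (toUnit _ ≫ η))
  inferInstance

/-- The product of two commutative group objects. -/
def prodGrp (G G' : CommGrp C) : CommGrp C where
  X := G.X ⊗ G'.X

/-- The first inclusion into a product of commutative group objects. -/
def prodInl (G G' : CommGrp C) : G ⟶ prodGrp G G' :=
  InducedCategory.homMk (Grp.ofHom (A := G.X) (B := G.X ⊗ G'.X) (lift (𝟙 G.X) 1))

/-- The second inclusion into a product of commutative group objects. -/
def prodInr (G G' : CommGrp C) : G' ⟶ prodGrp G G' :=
  InducedCategory.homMk (Grp.ofHom (A := G'.X) (B := G.X ⊗ G'.X) (lift 1 (𝟙 G'.X)))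

/-- The first projection from a product of commutative group objects. -/
def prodFst (G G' : CommGrp C) : prodGrp G G' ⟶ G :=
  InducedCategory.homMk (Grp.ofHom (A := G.X ⊗ G'.X) (B := G.X) (fst G.X G'.X))

/-- The second projection from a product of commutative group objects. -/
def prodSnd (G G' : CommGrp C) : prodGrp G G' ⟶ G' :=
  InducedCategory.homMk (Grp.ofHom (A := G.X ⊗ G'.X) (B := G'.X) (snd G.X G'.X))

theorem prodInl_fst (G G' : CommGrp C) :
    (prodInl G G').hom.hom.hom ≫ (prodFst G G').hom.hom.hom = 𝟙 G.X := lift_fst _ _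

theorem prodInl_snd (G G' : CommGrp C) :
    (prodInl G G').hom.hom.hom ≫ (prodSnd G G').hom.hom.hom = 1 := lift_snd _ _

theorem prodInr_fst (G G' : CommGrp C) :
    (prodInr G G').hom.hom.hom ≫ (prodFst G G').hom.hom.hom = 1 := lift_fst _ _

theorem prodInr_snd (G G' : CommGrp C) :
    (prodInr G G').hom.hom.hom ≫ (prodSnd G G').hom.hom.hom = 𝟙 G'.X := lift_snd _ _

theorem prodFst_inl_mul_prodSnd_inr (G G' : CommGrp C) :
    ((prodFst G G').hom.hom.hom ≫ (prodInl G G').hom.hom.hom) *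
      ((prodSnd G G').hom.hom.hom ≫ (prodInr G G').hom.hom.hom) = 𝟙 (prodGrp G G').X :=
  fst_comp_mul_snd_comp G.X G'.X

end Product

variable {S : Scheme.{u}} {k : Type u} [Field k]

theorem existsUnique_homOver_coequalizer {N G Z H : CommGrp (Over S)} {f g : N ⟶ G} (π : G ⟶ Z)
    (h : IsUniversalCoequalizer (translate f.hom.hom.hom) (translate g.hom.hom.hom) π.hom.hom.hom)
    (hH : IsAffine H.X.left) {T : Over S} (φ : HomOver G H T)
    (hφ : ((baseChange T).map f).hom ≫ φ = ((baseChange T).map g).hom ≫ φ) :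
    ∃! χ : HomOver Z H T, ((baseChange T).map π).hom ≫ χ = φ := by
  apply existsUnique_homOver_precomp π h hH
  rw [(isHomFamily_toFamily φ).translate_whiskerRight,
    (isHomFamily_toFamily φ).translate_whiskerRight, ← toFamily_precomp, hφ, toFamily_precomp]

theorem baseChange_comp_left {G G' G'' H : CommGrp (Over S)} {T : Over S} (f : G ⟶ G')
    (g : G' ⟶ G'') (φ : HomOver G'' H T) :
    ((baseChange T).map (f ≫ g)).hom ≫ φ =
      ((baseChange T).map f).hom ≫ ((baseChange T).map g).hom ≫ φ := by
  rw [Functor.map_comp]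
  exact Category.assoc _ _ _

/-- The homomorphism from the base change of a product with given restrictions to the factors. -/
def prodDesc {G G' H : CommGrp (Over S)} {T : Over S} (φ : HomOver G H T) (ψ : HomOver G' H T) :
    HomOver (prodGrp G G') H T :=
  (((baseChange T).map (prodFst G G')).hom ≫ φ) * (((baseChange T).map (prodSnd G G')).hom ≫ ψ)

theorem precomp_inl_prodDesc {G G' H : CommGrp (Over S)} {T : Over S} (φ : HomOver G H T)
    (ψ : HomOver G' H T) :
    ((baseChange T).map (prodInl G G')).hom ≫ prodDesc φ ψ = φ := by
  apply toFamily_injective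
  rw [toFamily_precomp, prodDesc, toFamily_mul, toFamily_precomp, toFamily_precomp,
    MonObj.comp_mul]
  rw [← comp_whiskerRight_assoc, ← comp_whiskerRight_assoc, prodInl_fst, prodInl_snd,
    id_whiskerRight, Category.id_comp, (isHomFamily_toFamily ψ).one_whiskerRight, mul_one]

theorem precomp_inr_prodDesc {G G' H : CommGrp (Over S)} {T : Over S} (φ : HomOver G H T)
    (ψ : HomOver G' H T) :
    ((baseChange T).map (prodInr G G')).hom ≫ prodDesc φ ψ = ψ := by
  apply toFamily_injective
  rw [toFamily_precomp, prodDesc, toFamily_mul, toFamily_precomp, toFamily_precomp,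
    MonObj.comp_mul]
  rw [← comp_whiskerRight_assoc, ← comp_whiskerRight_assoc, prodInr_fst, prodInr_snd,
    id_whiskerRight, Category.id_comp, (isHomFamily_toFamily φ).one_whiskerRight, one_mul]

/-- Because `(x, y) = (x, 1)(1, y)`, a multiplicative family on a product is the product of its
restrictions to the two factors. -/
theorem prodGrp_homOver_ext {G G' H : CommGrp (Over S)} {T : Over S}
    {χ χ' : HomOver (prodGrp G G') H T}
    (h : ((baseChange T).map (prodInl G G')).hom ≫ χ = ((baseChange T).map (prodInl G G')).hom ≫ χ')
    (h' : ((baseChange T).map (prodInr G G')).hom ≫ χ =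
      ((baseChange T).map (prodInr G G')).hom ≫ χ') : χ = χ' := by
  have key (x : HomOver (prodGrp G G') H T) : toFamily x =
      ((prodFst G G').hom.hom.hom ▷ T ≫
        toFamily (((baseChange T).map (prodInl G G')).hom ≫ x)) *
      ((prodSnd G G').hom.hom.hom ▷ T ≫
        toFamily (((baseChange T).map (prodInr G G')).hom ≫ x)) := by
    rw [toFamily_precomp, toFamily_precomp, ← comp_whiskerRight_assoc, ← comp_whiskerRight_assoc,
      ← (isHomFamily_toFamily x).mul_whiskerRight, prodFst_inl_mul_prodSnd_inr, id_whiskerRight,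
      Category.id_comp]
  apply toFamily_injective
  rw [key χ, key χ', h, h']

/-- `Z` is the quotient of `G × G'` that identifies `(f(n), 1)` with `(1, g(n))`. The universal
property is stated over every `T`, so that it yields both the categorical pushout and the fibre
product of Hom groups. -/
theorem exists_pushout {N G G' : CommGrp (Over (Spec (.of k)))} (hN : IsAffine N.X.left)
    (hG : IsAffine G.X.left) (hG' : IsAffine G'.X.left) (f : N ⟶ G) (g : N ⟶ G') :
    ∃ (Z : CommGrp (Over (Spec (.of k)))) (a : G ⟶ Z) (b : G' ⟶ Z), IsAffine Z.X.left ∧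
      (IsFinite G.X.hom → IsFinite G'.X.hom → IsFinite Z.X.hom) ∧ f ≫ a = g ≫ b ∧
      ∀ (H : CommGrp (Over (Spec (.of k)))), IsAffine H.X.left → ∀ (T : Over (Spec (.of k)))
        (φ : HomOver G H T) (ψ : HomOver G' H T),
        ((baseChange T).map f).hom ≫ φ = ((baseChange T).map g).hom ≫ ψ →
        ∃! χ : HomOver Z H T, ((baseChange T).map a).hom ≫ χ = φ ∧
          ((baseChange T).map b).hom ≫ χ = ψ := by
  have hP : IsAffine (prodGrp G G').X.left :=
    inferInstanceAs (IsAffine (pullback G.X.hom G'.X.hom))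
  obtain ⟨Z, π, hZ, hfin, hπ⟩ := exists_quotient hN hP (f ≫ prodInl G G') (g ≫ prodInr G G')
  refine ⟨Z, prodInl G G' ≫ π, prodInr G G' ≫ π, hZ, fun h h' ↦ hfin ?_, ?_, ?_⟩
  -- The projection `G × G' ⟶ G` is a base change of `G'` over `k`.
  · exact MorphismProperty.comp_mem @IsFinite (pullback.fst G.X.hom G'.X.hom) G.X.hom
      inferInstance h
  -- Evaluating the translation condition at `(n, 1)` recovers the equality of homomorphisms on `N`.
  · have := lift (𝟙 N.X) (1 : N.X ⟶ (prodGrp G G').X) ≫= hπ.condition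
    rw [← Category.assoc, ← Category.assoc, lift_translate, lift_translate, mul_one, mul_one,
      Category.id_comp, Category.id_comp] at this
    rw [← Category.assoc, ← Category.assoc]
    exact InducedCategory.hom_ext (Grp.hom_ext _ _ this)
  · intro H hH T φ ψ h
    obtain ⟨χ, hχ, hu⟩ := existsUnique_homOver_coequalizer π hπ hH (prodDesc φ ψ) (by
      rw [baseChange_comp_left, baseChange_comp_left, precomp_inl_prodDesc, precomp_inr_prodDesc,
        h])
    refine ⟨χ, ⟨?_, ?_⟩, ?_⟩
    · rw [baseChange_comp_left, hχ, precomp_inl_prodDesc]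
    · rw [baseChange_comp_left, hχ, precomp_inr_prodDesc]
    · rintro χ' ⟨h1, h2⟩
      refine hu _ (prodGrp_homOver_ext ?_ ?_)
      · rw [← baseChange_comp_left, h1, precomp_inl_prodDesc]
      · rw [← baseChange_comp_left, h2, precomp_inr_prodDesc]

end

/-! ### `Hom(-, H)` sends finite colimits to limits and is left exact -/

section

theorem isPushout_of_existsUnique {D : Type*} [Category* D] {X Y Z P : D} {f : Z ⟶ X} {g : Z ⟶ Y}
    {a : X ⟶ P} {b : Y ⟶ P} (w : f ≫ a = g ≫ b)
    (h : ∀ ⦃W : D⦄ (x : X ⟶ W) (y : Y ⟶ W), f ≫ x = g ≫ y → ∃! z : P ⟶ W, a ≫ z = x ∧ b ≫ z = y) :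
    IsPushout f g a b :=
  ⟨⟨w⟩, ⟨PushoutCocone.IsColimit.mk _ (fun s ↦ (h s.inl s.inr s.condition).choose)
    (fun s ↦ (h s.inl s.inr s.condition).choose_spec.1.1)
    (fun s ↦ (h s.inl s.inr s.condition).choose_spec.1.2)
    (fun s m h₁ h₂ ↦ (h s.inl s.inr s.condition).choose_spec.2 m ⟨h₁, h₂⟩)⟩⟩

/-- Terminal objects and pullbacks generate finite limits, and limits are unique up to isomorphism:
one preserved cone of each kind suffices, and it also shows that the limit exists in `D`. -/
theorem preservesFiniteLimits_of_exists_isPullback {D E : Type*} [Category* D] [Category* E]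
    (F : D ⥤ E) (hT : ∃ X : D, Nonempty (IsTerminal X) ∧ Nonempty (IsTerminal (F.obj X)))
    (hP : ∀ ⦃X Y Z : D⦄ (f : X ⟶ Z) (g : Y ⟶ Z), ∃ (P : D) (p : P ⟶ X) (q : P ⟶ Y),
      IsPullback p q f g ∧ IsPullback (F.map p) (F.map q) (F.map f) (F.map g)) :
    PreservesFiniteLimits F := by
  obtain ⟨X, ⟨hX⟩, ⟨hFX⟩⟩ := hT
  have : HasTerminal D := hX.hasTerminal
  have : HasPullbacks D := by
    have h {X Y Z : D} (f : X ⟶ Z) (g : Y ⟶ Z) : HasLimit (cospan f g) := by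
      obtain ⟨P, p, q, h, -⟩ := hP f g
      exact ⟨⟨_, h.isLimit⟩⟩
    exact hasPullbacks_of_hasLimit_cospan D
  have h1 : PreservesLimit (Functor.empty.{0} D) F := by
    refine preservesLimit_of_preserves_limit_cone hX ?_
    exact (isLimitMapConeEmptyConeEquiv F X).symm hFX
  have : PreservesLimitsOfShape (Discrete.{0} PEmpty) F :=
    preservesLimitsOfShape_pempty_of_preservesTerminal F
  have : PreservesLimitsOfShape WalkingCospan F := ⟨fun {K} ↦ by
    obtain ⟨P, p, q, h, h'⟩ := hP (K.map WalkingCospan.Hom.inl) (K.map WalkingCospan.Hom.inr)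
    have := h.preservesLimit_cospan_iff.2 h'
    exact preservesLimit_of_iso_diagram F (diagramIsoCospan K).symm⟩
  exact preservesFiniteLimits_of_preservesTerminal_and_pullbacks F

/-- Limits of functors are pointwise, and the forgetful functor from groups to sets reflects finite
limits. -/
theorem preservesFiniteLimits_of_comp_evaluation_forget {D K : Type*} [Category* D] [Category* K]
    (F : D ⥤ K ⥤ CommGrpCat.{u})
    (h : ∀ T : K, PreservesFiniteLimits (F ⋙ (evaluation _ _).obj T ⋙ forget CommGrpCat.{u})) :
    PreservesFiniteLimits F := by
  apply preservesFiniteLimits_of_evaluation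
  intro T
  have : PreservesFiniteLimits ((F ⋙ (evaluation _ _).obj T) ⋙ forget CommGrpCat.{u}) := h T
  exact preservesFiniteLimits_of_reflects_of_preserves _ (forget CommGrpCat.{u})

variable {S : Scheme.{u}} {k : Type u} [Field k]

theorem toFamily_id {G : CommGrp (Over S)} {T : Over S} :
    toFamily (𝟙 _ : HomOver G G T) = fst G.X T :=
  Over.OverMorphism.ext ((toFamily_left _).trans (Category.id_comp _))

theorem toFamily_map {G H : CommGrp (Over S)} {T : Over S} (f : G ⟶ H) :
    toFamily ((baseChange T).map f).hom = fst G.X T ≫ f.hom.hom.hom := by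
  rw [← whiskerRight_fst, ← toFamily_id, ← toFamily_precomp]
  congr 1

theorem toFamily_one {G H : CommGrp (Over S)} {T : Over S} :
    toFamily (1 : HomOver G H T) = 1 := by
  have h := toFamily_mul (1 : HomOver G H T) 1
  rwa [mul_one, left_eq_mul] at h

theorem precomp_eq_one_of_isKernel {N G Q H : CommGrp (Over S)} {i : N ⟶ G} {π : G ⟶ Q}
    (h : IsKernel i π) {T : Over S} (χ : HomOver Q H T) :
    ((baseChange T).map i).hom ≫ ((baseChange T).map π).hom ≫ χ = 1 := by
  apply toFamily_injective
  rw [toFamily_precomp, toFamily_precomp, ← comp_whiskerRight_assoc, h.w, toFamily_one]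
  exact (isHomFamily_toFamily χ).one_whiskerRight

/-- Taking `T` to be the base itself recovers ordinary homomorphisms, so a universal property valid
over all `T` specializes to one in the category of groups. -/
theorem existsUnique_baseChange_unit {G H : CommGrp (Over S)} (φ : HomOver G H (𝟙_ (Over S))) :
    ∃! f : G ⟶ H, ((baseChange (𝟙_ (Over S))).map f).hom = φ := by
  have e : fst G.X (𝟙_ (Over S)) ≫ lift (𝟙 _) (toUnit _) = 𝟙 _ := by
    apply CartesianMonoidalCategory.hom_ext
    · rw [Category.assoc, lift_fst, Category.comp_id, Category.id_comp]
    · exact toUnit_unique _ _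
  have hm : IsMonHom (lift (𝟙 _) (toUnit _) ≫ toFamily φ) := by
    apply isMonHom_of_comp_mul
    intro Y x y
    have h := isHomFamily_toFamily φ x y (toUnit _)
    have hx (x : Y ⟶ G.X) : x ≫ lift (𝟙 _) (toUnit _) = lift x (toUnit Y) := by
      rw [comp_lift, Category.comp_id, comp_toUnit]
    rwa [← Category.assoc, ← Category.assoc, ← Category.assoc, hx, hx, hx]
  refine ⟨InducedCategory.homMk (Grp.ofHom (lift (𝟙 _) (toUnit _) ≫ toFamily φ)), ?_, ?_⟩
  · apply toFamily_injective
    rw [toFamily_map]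
    refine (Category.assoc _ _ _).symm.trans ?_
    rw [e, Category.id_comp]
  · rintro f rfl
    refine InducedCategory.hom_ext (Grp.hom_ext _ _ ?_)
    change _ = lift (𝟙 _) (toUnit _) ≫ toFamily _
    rw [toFamily_map, ← Category.assoc, lift_fst, Category.id_comp]

instance (H : CommGrp (Over S)) (T : Over S) :
    Subsingleton (HomOver (CommGrp.trivial (Over S)) H T) := ⟨fun φ ψ ↦ by
  apply toFamily_injective
  have h (χ : HomOver (CommGrp.trivial (Over S)) H T) : toFamily χ = 1 := by
    rw [← (isHomFamily_toFamily χ).one_whiskerRight (X := (CommGrp.trivial (Over S)).X)]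
    refine (Category.id_comp _).symm.trans ?_
    rw [← id_whiskerRight]
    congr 2
  rw [h, h]⟩

/-- The property `P` lets one argument serve for affine and for finite groups: all that is used is
that it contains the trivial group and the pushouts of `exists_pushout`. -/
theorem preservesFiniteLimits_innerHom_flip (P : ObjectProperty (CommGrp (Over (Spec (.of k)))))
    (hP : P ≤ isAffineGroup k) (htriv : P (CommGrp.trivial _))
    (hpush : ∀ ⦃G G' Z : CommGrp (Over (Spec (.of k)))⦄, P G → P G' → IsAffine Z.X.left →
      (IsFinite G.X.hom → IsFinite G'.X.hom → IsFinite Z.X.hom) → P Z)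
    (H : CommGrp (Over (Spec (.of k)))) (hH : IsAffine H.X.left) :
    PreservesFiniteLimits (P.ι.op ⋙ (innerHom (Spec (.of k))).flip.obj H) := by
  apply preservesFiniteLimits_of_comp_evaluation_forget
  intro T
  apply preservesFiniteLimits_of_exists_isPullback
  · refine ⟨op ⟨_, htriv⟩, ⟨?_⟩, ⟨?_⟩⟩
    · refine terminalOpOfInitial (IsInitial.ofUniqueHom
        (fun X ↦ ObjectProperty.homMk (CommGrp.uniqueHomFromTrivial X.obj).default) ?_)
      intro X f
      exact ObjectProperty.hom_ext _ ((CommGrp.uniqueHomFromTrivial X.obj).uniq _)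
    · refine (Types.isTerminalEquivUnique _).symm ⟨⟨(1 : HomOver _ H T.unop)⟩, fun φ ↦ ?_⟩
      exact Subsingleton.elim (α := HomOver (CommGrp.trivial _) H T.unop) φ 1
  · intro G G' N f g
    obtain ⟨Z, a, b, hZ, hfin, w, h⟩ := exists_pushout (hP _ N.unop.2) (hP _ G.unop.2)
      (hP _ G'.unop.2) f.unop.hom g.unop.hom
    refine ⟨op ⟨Z, hpush G.unop.2 G'.unop.2 hZ hfin⟩, Quiver.Hom.op (ObjectProperty.homMk a),
      Quiver.Hom.op (ObjectProperty.homMk b), ?_, ?_⟩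
    · let Z' : P.FullSubcategory := ⟨Z, hpush G.unop.2 G'.unop.2 hZ hfin⟩
      let a' : G.unop ⟶ Z' := ObjectProperty.homMk a
      let b' : G'.unop ⟶ Z' := ObjectProperty.homMk b
      have w' : f.unop ≫ a' = g.unop ≫ b' := ObjectProperty.hom_ext _ w
      refine (isPushout_of_existsUnique w'
        fun W x y hxy ↦ ?_).op.flip
      have hxy' : f.unop.hom ≫ x.hom = g.unop.hom ≫ y.hom := congr_arg (·.hom) hxy
      have key {A B C : CommGrp (Over (Spec (.of k)))} (u : A ⟶ B) (v : B ⟶ C) :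
          ((baseChange (𝟙_ _)).map (u ≫ v)).hom =
            ((baseChange (𝟙_ _)).map u).hom ≫ ((baseChange (𝟙_ _)).map v).hom := by
        rw [Functor.map_comp]; rfl
      -- The case where `T` is the base gives the pushout in the category itself.
      obtain ⟨χ, ⟨hx, hy⟩, hu⟩ := h W.obj (hP _ W.2) (𝟙_ _) ((baseChange (𝟙_ _)).map x.hom).hom
        ((baseChange (𝟙_ _)).map y.hom).hom (by rw [← key, hxy', key])
      obtain ⟨z, rfl, -⟩ := existsUnique_baseChange_unit χ
      refine ⟨ObjectProperty.homMk z, ⟨ObjectProperty.hom_ext _ ?_,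
        ObjectProperty.hom_ext _ ?_⟩, ?_⟩
      · exact (existsUnique_baseChange_unit _).unique ((key a z).trans hx) rfl
      · exact (existsUnique_baseChange_unit _).unique ((key b z).trans hy) rfl
      · rintro z' ⟨rfl, rfl⟩
        refine ObjectProperty.hom_ext _ ((existsUnique_baseChange_unit _).unique ?_ rfl)
        exact hu _ ⟨(key _ _).symm, (key _ _).symm⟩
    · rw [Types.isPullback_iff]
      refine ⟨?_, ?_, ?_⟩
      · rw [← Functor.map_comp, ← Functor.map_comp]
        congr 1
        exact Quiver.Hom.unop_inj (ObjectProperty.hom_ext _ w)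
      · rintro (χ χ' : HomOver Z H T.unop) ⟨h₁, h₂⟩
        have e : ((baseChange T.unop).map f.unop.hom).hom ≫ ((baseChange T.unop).map a).hom ≫ χ' =
            ((baseChange T.unop).map g.unop.hom).hom ≫ ((baseChange T.unop).map b).hom ≫ χ' := by
          rw [← baseChange_comp_left, w, baseChange_comp_left]
        exact (h H hH T.unop _ _ e).unique ⟨h₁, h₂⟩ ⟨rfl, rfl⟩
      · rintro (φ : HomOver G.unop.obj H T.unop) (ψ : HomOver G'.unop.obj H T.unop) e
        exact (h H hH T.unop φ ψ e).exists

theorem preservesFiniteLimits_homInto (H : AffGrp k) : PreservesFiniteLimits (homInto H) :=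
  preservesFiniteLimits_innerHom_flip (isAffineGroup k) le_rfl
    (inferInstanceAs (IsAffine (Spec (.of k)))) (fun _ _ _ _ _ h _ ↦ h) H.obj H.property

theorem preservesFiniteLimits_finHomInto (H : AffGrp k) : PreservesFiniteLimits (finHomInto H) := by
  have : PreservesFiniteLimits
      ((isFiniteGroup k).ι.op ⋙ (innerHom (Spec (.of k))).flip.obj H.obj) :=
    preservesFiniteLimits_innerHom_flip (isFiniteGroup k) (isFiniteGroup_le k)
      (inferInstanceAs (IsFinite (𝟙 (Spec (.of k))))) (fun _ _ _ h h' _ h'' ↦ h'' h h')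
      H.obj H.property
  exact this

theorem isLeftExactSeq_iff {P Q R : (Over S)ᵒᵖ ⥤ CommGrpCat.{u}} {α : P ⟶ Q} {β : Q ⟶ R} :
    IsLeftExactSeq α β ↔ ∀ T : Over S, Function.Injective (α.app (op T)).hom ∧
      (∀ x, (β.app (op T)).hom ((α.app (op T)).hom x) = 1) ∧
      ∀ y, (β.app (op T)).hom y = 1 → ∃ x, (α.app (op T)).hom x = y := by
  refine forall_congr' fun T ↦ and_congr_right' ?_
  rw [SetLike.ext_iff, forall_congr' fun x ↦ iff_iff_implies_and_implies, forall_and]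
  refine and_congr_left' ⟨fun h x ↦ h _ ⟨x, rfl⟩, ?_⟩
  rintro h _ ⟨x, rfl⟩
  exact h x

theorem one_innerHomPresheaf (G H : CommGrp (Over S)) (T : Over S) :
    (1 : (innerHomPresheaf G H).obj (op T)) = (1 : HomOver G H T) := (rfl)

theorem innerHomMapLeft_app_hom {G G' : CommGrp (Over S)} (g : G' ⟶ G) (H : CommGrp (Over S))
    (T : Over S) (φ : HomOver G H T) :
    ((innerHomMapLeft g H).app (op T)).hom φ = ((baseChange T).map g).hom ≫ φ := (rfl)

theorem innerHomMapRight_app_hom (G : CommGrp (Over S)) {H H' : CommGrp (Over S)} (f : H ⟶ H')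
    (T : Over S) (φ : HomOver G H T) :
    ((innerHomMapRight G f).app (op T)).hom φ = φ ≫ ((baseChange T).map f).hom := (rfl)

set_option maxHeartbeats 400000 in
theorem isLeftExactSeq_innerHomMapLeft {N G Q H : CommGrp (Over S)} {i : N ⟶ G} {π : G ⟶ Q}
    (hi : IsKernel i π)
    (h : ∀ T, ∀ φ : HomOver G H T, i.hom.hom.hom ▷ T ≫ toFamily φ = 1 →
      ∃ χ : HomOver Q H T, ((baseChange T).map π).hom ≫ χ = φ)
    (hinj : ∀ T, ∀ χ χ' : HomOver Q H T,
      ((baseChange T).map π).hom ≫ χ = ((baseChange T).map π).hom ≫ χ' → χ = χ') :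
    IsLeftExactSeq (innerHomMapLeft π H) (innerHomMapLeft i H) := by
  refine isLeftExactSeq_iff.2 ?_
  intro T
  refine ⟨hinj T, ?_, ?_⟩
  · intro (χ : HomOver Q H T)
    exact precomp_eq_one_of_isKernel hi χ
  · intro (φ : HomOver G H T) e
    have hφ : ((baseChange T).map i).hom ≫ φ = 1 :=
      (innerHomMapLeft_app_hom i H T φ).symm.trans (e.trans (one_innerHomPresheaf N H T))
    refine h T φ ?_
    rw [← toFamily_precomp, hφ, toFamily_one]

theorem IsShortExact.isLeftExactSeq_innerHomMapLeft {N G Q H : CommGrp (Over (Spec (.of k)))}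
    (hH : IsAffine H.X.left) (hG : IsAffine G.X.left)
    (hQ : IsAffine Q.X.left) {i : N ⟶ G} {π : G ⟶ Q} (h : IsShortExact i π) :
    IsLeftExactSeq (innerHomMapLeft π H) (innerHomMapLeft i H) := by
  have hπ := isUniversalCoequalizer_of_isShortExact h hG hQ
  refine GroupScheme.isLeftExactSeq_innerHomMapLeft h.isKernel (fun T φ hφ ↦ ?_)
    fun T χ χ' e ↦ ?_
  · refine (existsUnique_homOver_precomp π hπ hH φ ?_).exists
    -- Triviality on `N` makes `φ` invariant under translation by `N`, which is the descent
    -- condition for `π`.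
    rw [(isHomFamily_toFamily φ).translate_whiskerRight, hφ, MonObj.comp_one, one_mul]
  · refine (existsUnique_homOver_precomp π hπ hH (((baseChange T).map π).hom ≫ χ) ?_).unique rfl
      (Eq.symm e)
    rw [toFamily_precomp, ← comp_whiskerRight_assoc, ← comp_whiskerRight_assoc, hπ.condition]

end

/-! ### `Hom(H, -)` preserves finite limits and is left exact -/

section

section
variable {C : Type*} [Category* C] [CartesianMonoidalCategory C]

/-- The two projections are homomorphisms and jointly monic, so multiplicativity is checked
componentwise. -/
theorem IsHomFamily.of_isPullback {G T P X Y Z : C} [MonObj G] [MonObj P] [MonObj X] [MonObj Y]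
    {p : P ⟶ X} {q : P ⟶ Y} {f : X ⟶ Z} {g : Y ⟶ Z} [IsMonHom p] [IsMonHom q]
    (h : IsPullback p q f g) {F : G ⊗ T ⟶ P} (hp : IsHomFamily (F ≫ p))
    (hq : IsHomFamily (F ≫ q)) : IsHomFamily F := by
  intro W x y t
  apply h.hom_ext
  · rw [MonObj.mul_comp, Category.assoc, Category.assoc, Category.assoc, hp]
  · rw [MonObj.mul_comp, Category.assoc, Category.assoc, Category.assoc, hq]

variable [BraidedCategory C]

theorem isCommMonObj_of_isPullback {P X Y Z : C} [MonObj P] [MonObj X] [MonObj Y]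
    [IsCommMonObj X] [IsCommMonObj Y] {p : P ⟶ X} {q : P ⟶ Y} {f : X ⟶ Z} {g : Y ⟶ Z}
    [IsMonHom p] [IsMonHom q] (h : IsPullback p q f g) : IsCommMonObj P where
  mul_comm := by
    apply h.hom_ext
    · rw [Category.assoc, IsMonHom.mul_hom, ← BraidedCategory.braiding_naturality_assoc,
        IsCommMonObj.mul_comm]
    · rw [Category.assoc, IsMonHom.mul_hom, ← BraidedCategory.braiding_naturality_assoc,
        IsCommMonObj.mul_comm]

/-- The homomorphism to the trivial group. -/
def toTrivial (G : CommGrp C) : G ⟶ CommGrp.trivial C :=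
  have : IsMonHom (toUnit G.X) := isMonHom_of_comp_mul _ fun _ _ _ ↦ toUnit_unique _ _
  InducedCategory.homMk (Grp.ofHom (A := G.X) (B := 𝟙_ C) (toUnit G.X))

/-- The homomorphism from the trivial group. -/
def ofTrivial (G : CommGrp C) : CommGrp.trivial C ⟶ G :=
  InducedCategory.homMk (Grp.ofHom (A := 𝟙_ C) (B := G.X) η[G.X])

/-- The pullback of group objects has the pullback as underlying object, and commutativity is
inherited through the projections. -/
theorem exists_commGrp_isPullback [HasPullbacks C] {X Y Z : CommGrp C} (f : X ⟶ Z) (g : Y ⟶ Z) :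
    ∃ (P : CommGrp C) (p : P ⟶ X) (q : P ⟶ Y),
      IsPullback p.hom.hom.hom q.hom.hom.hom f.hom.hom.hom g.hom.hom.hom := by
  have h : IsPullback (pullback.fst f.hom g.hom).hom.hom (pullback.snd f.hom g.hom).hom.hom
      f.hom.hom.hom g.hom.hom.hom := (IsPullback.of_hasPullback f.hom g.hom).map (Grp.forget C)
  have : IsCommMonObj (pullback f.hom g.hom).X := isCommMonObj_of_isPullback h
  exact ⟨⟨(pullback f.hom g.hom).X⟩, InducedCategory.homMk (pullback.fst f.hom g.hom),
    InducedCategory.homMk (pullback.snd f.hom g.hom), h⟩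

end

variable {S : Scheme.{u}} {k : Type u} [Field k]

theorem existsUnique_homOver_postcomp {H P X Y Z : CommGrp (Over S)} {p : P ⟶ X} {q : P ⟶ Y}
    {f : X ⟶ Z} {g : Y ⟶ Z}
    (h : IsPullback p.hom.hom.hom q.hom.hom.hom f.hom.hom.hom g.hom.hom.hom) {T : Over S}
    (φ : HomOver H X T) (ψ : HomOver H Y T)
    (e : φ ≫ ((baseChange T).map f).hom = ψ ≫ ((baseChange T).map g).hom) :
    ∃! χ : HomOver H P T, χ ≫ ((baseChange T).map p).hom = φ ∧
      χ ≫ ((baseChange T).map q).hom = ψ := by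
  have e' : toFamily φ ≫ f.hom.hom.hom = toFamily ψ ≫ g.hom.hom.hom := by
    rw [← toFamily_postcomp, e, toFamily_postcomp]
  obtain ⟨χ, hχ⟩ := exists_toFamily_eq (f := h.lift _ _ e') (IsHomFamily.of_isPullback h
    (by rw [h.lift_fst]; exact isHomFamily_toFamily φ)
    (by rw [h.lift_snd]; exact isHomFamily_toFamily ψ))
  refine ⟨χ, ⟨?_, ?_⟩, ?_⟩
  · apply toFamily_injective
    rw [toFamily_postcomp, hχ, h.lift_fst]
  · apply toFamily_injective
    rw [toFamily_postcomp, hχ, h.lift_snd]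
  · rintro χ' ⟨rfl, rfl⟩
    apply toFamily_injective
    rw [hχ]
    apply h.hom_ext
    · rw [h.lift_fst, toFamily_postcomp]
    · rw [h.lift_snd, toFamily_postcomp]

theorem homOver_ext_of_isPullback {H P X Y Z : CommGrp (Over S)} {p : P ⟶ X} {q : P ⟶ Y}
    {f : X ⟶ Z} {g : Y ⟶ Z}
    (h : IsPullback p.hom.hom.hom q.hom.hom.hom f.hom.hom.hom g.hom.hom.hom) {T : Over S}
    {χ χ' : HomOver H P T} (h₁ : χ ≫ ((baseChange T).map p).hom = χ' ≫ ((baseChange T).map p).hom)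
    (h₂ : χ ≫ ((baseChange T).map q).hom = χ' ≫ ((baseChange T).map q).hom) : χ = χ' := by
  apply toFamily_injective
  apply h.hom_ext
  · rw [← toFamily_postcomp, h₁, toFamily_postcomp]
  · rw [← toFamily_postcomp, h₂, toFamily_postcomp]

theorem one_postcomp {G H H' : CommGrp (Over S)} {T : Over S} (f : H ⟶ H') :
    (1 : HomOver G H T) ≫ ((baseChange T).map f).hom = 1 := by
  apply toFamily_injective
  rw [toFamily_postcomp, toFamily_one, toFamily_one, MonObj.one_comp]

instance (H : CommGrp (Over S)) (T : Over S) :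
    Subsingleton (HomOver H (CommGrp.trivial (Over S)) T) :=
  ⟨fun _ _ ↦ toFamily_injective (toUnit_unique _ _)⟩

theorem baseChange_comp_right {G H H' H'' : CommGrp (Over S)} {T : Over S} (φ : HomOver G H T)
    (f : H ⟶ H') (g : H' ⟶ H'') :
    φ ≫ ((baseChange T).map (f ≫ g)).hom =
      (φ ≫ ((baseChange T).map f).hom) ≫ ((baseChange T).map g).hom := by
  rw [Functor.map_comp]
  exact (Category.assoc _ _ _).symm

theorem isPullback_of_existsUnique {D : Type*} [Category* D] {X Y Z P : D} {f : X ⟶ Z} {g : Y ⟶ Z}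
    {a : P ⟶ X} {b : P ⟶ Y} (w : a ≫ f = b ≫ g)
    (h : ∀ ⦃W : D⦄ (x : W ⟶ X) (y : W ⟶ Y), x ≫ f = y ≫ g → ∃! z : W ⟶ P, z ≫ a = x ∧ z ≫ b = y) :
    IsPullback a b f g :=
  ⟨⟨w⟩, ⟨PullbackCone.IsLimit.mk _ (fun s ↦ (h s.fst s.snd s.condition).choose)
    (fun s ↦ (h s.fst s.snd s.condition).choose_spec.1.1)
    (fun s ↦ (h s.fst s.snd s.condition).choose_spec.1.2)
    (fun s m h₁ h₂ ↦ (h s.fst s.snd s.condition).choose_spec.2 m ⟨h₁, h₂⟩)⟩⟩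

theorem isPullback_commGrp {C : Type*} [Category* C] [CartesianMonoidalCategory C]
    [BraidedCategory C] {P X Y Z : CommGrp C} {p : P ⟶ X} {q : P ⟶ Y} {f : X ⟶ Z} {g : Y ⟶ Z}
    (h : IsPullback p.hom.hom.hom q.hom.hom.hom f.hom.hom.hom g.hom.hom.hom) :
    IsPullback p q f g := by
  refine isPullback_of_existsUnique (InducedCategory.hom_ext (Grp.hom_ext _ _ h.w)) ?_
  intro W x y e
  have e' : x.hom.hom.hom ≫ f.hom.hom.hom = y.hom.hom.hom ≫ g.hom.hom.hom :=
    congr_arg (·.hom.hom.hom) e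
  have : IsMonHom (h.lift _ _ e') := isMonHom_of_comp_mul _ fun T a b ↦ by
    apply h.hom_ext <;>
    simp only [MonObj.mul_comp, Category.assoc, h.lift_fst, h.lift_snd]
  refine ⟨InducedCategory.homMk (Grp.ofHom (h.lift _ _ e')),
    ⟨InducedCategory.hom_ext (Grp.hom_ext _ _ (h.lift_fst _ _ _)),
      InducedCategory.hom_ext (Grp.hom_ext _ _ (h.lift_snd _ _ _))⟩, ?_⟩
  rintro z ⟨rfl, rfl⟩
  refine InducedCategory.hom_ext (Grp.hom_ext _ _ (h.hom_ext ?_ ?_))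
  · exact (h.lift_fst _ _ _).symm
  · exact (h.lift_snd _ _ _).symm

theorem isAffine_of_isPullback {P X Y Z : Over S} {p : P ⟶ X} {q : P ⟶ Y} {f : X ⟶ Z} {g : Y ⟶ Z}
    (h : IsPullback p q f g) (hX : IsAffine X.left) (hY : IsAffine Y.left) (hZ : IsAffine Z.left) :
    IsAffine P.left := by
  let e : P.left ≅ pullback f.left g.left := (h.map (Over.forget S)).isoPullback
  exact .of_isIso e.hom

theorem preservesFiniteLimits_homFrom (H : AffGrp k) : PreservesFiniteLimits (homFrom H) := by
  apply preservesFiniteLimits_of_comp_evaluation_forget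
  intro T
  apply preservesFiniteLimits_of_exists_isPullback
  · refine ⟨⟨CommGrp.trivial _, inferInstanceAs (IsAffine (Spec (.of k)))⟩, ⟨?_⟩, ⟨?_⟩⟩
    · refine IsTerminal.ofUniqueHom (fun X ↦ ObjectProperty.homMk (toTrivial X.obj)) ?_
      intro X f
      exact ObjectProperty.hom_ext _
        (InducedCategory.hom_ext (Grp.hom_ext _ _ (toUnit_unique _ _)))
    · refine (Types.isTerminalEquivUnique _).symm ⟨⟨(1 : HomOver H.obj _ T.unop)⟩, fun φ ↦ ?_⟩
      exact Subsingleton.elim (α := HomOver H.obj (CommGrp.trivial _) T.unop) φ 1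
  · intro X Y Z f g
    obtain ⟨P, p, q, h⟩ := exists_commGrp_isPullback f.hom g.hom
    let P' : AffGrp k := ⟨P, isAffine_of_isPullback h X.property Y.property Z.property⟩
    let p' : P' ⟶ X := ObjectProperty.homMk p
    let q' : P' ⟶ Y := ObjectProperty.homMk q
    have w : p ≫ f.hom = q ≫ g.hom := (isPullback_commGrp h).w
    have w' : p' ≫ f = q' ≫ g := ObjectProperty.hom_ext _ w
    refine ⟨P', p', q', .of_map (isAffineGroup k).ι w' (isPullback_commGrp h), ?_⟩
    rw [Types.isPullback_iff]
    refine ⟨by rw [← Functor.map_comp, ← Functor.map_comp, w'], ?_, ?_⟩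
    · rintro (χ χ' : HomOver H.obj P T.unop) ⟨h₁, h₂⟩
      exact homOver_ext_of_isPullback h h₁ h₂
    · rintro (φ : HomOver H.obj X.obj T.unop) (ψ : HomOver H.obj Y.obj T.unop) e
      exact (existsUnique_homOver_postcomp h φ ψ e).exists

set_option maxHeartbeats 400000 in
theorem isLeftExactSeq_innerHomMapRight {N G Q H : CommGrp (Over S)} {i : N ⟶ G} {π : G ⟶ Q}
    (h : IsKernel i π) : IsLeftExactSeq (innerHomMapRight H i) (innerHomMapRight H π) := by
  -- The kernel square has the trivial group in its corner and consists of homomorphisms, so the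
  -- lemmas on fibre products apply to it.
  have h' : IsPullback i.hom.hom.hom (toTrivial N).hom.hom.hom π.hom.hom.hom
    (ofTrivial Q).hom.hom.hom := h
  refine isLeftExactSeq_iff.2 fun T ↦ ⟨?_, ?_, ?_⟩
  · intro (χ : HomOver H N T) (χ' : HomOver H N T) e
    exact homOver_ext_of_isPullback h' e (Subsingleton.elim _ _)
  · intro (χ : HomOver H N T)
    have : χ ≫ ((baseChange T).map (toTrivial N)).hom = 1 := Subsingleton.elim _ _
    have hχ : (χ ≫ ((baseChange T).map i).hom) ≫ ((baseChange T).map π).hom = 1 := by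
      rw [← baseChange_comp_right, (isPullback_commGrp h').w, baseChange_comp_right, this,
        one_postcomp]
    exact hχ.trans (one_innerHomPresheaf H Q T).symm
  · intro (φ : HomOver H G T) e
    have hφ : φ ≫ ((baseChange T).map π).hom = 1 :=
      (innerHomMapRight_app_hom H π T φ).symm.trans (e.trans (one_innerHomPresheaf H Q T))
    obtain ⟨χ, ⟨hχ, -⟩, -⟩ := existsUnique_homOver_postcomp h' φ 1 (hφ.trans (one_postcomp _).symm)
    exact ⟨χ, hχ⟩

end

/-! ### Representability of morphisms out of a finite scheme -/

section

section AlgebraicRestriction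
open TensorProduct

theorem equivFinsuppOfBasisLeft_map {k A B B' κ : Type*} [CommRing k] [CommRing A] [Algebra k A]
    [DecidableEq κ] (b : Module.Basis κ k A) [CommRing B] [Algebra k B] [CommRing B'] [Algebra k B']
    (g : B →ₐ[k] B') (z : A ⊗[k] B) (i : κ) :
    TensorProduct.equivFinsuppOfBasisLeft b (Algebra.TensorProduct.map (.id k A) g z) i =
      g (TensorProduct.equivFinsuppOfBasisLeft b z i) := by
  induction z with
  | zero => simp
  | add x y hx hy => simp [hx, hy]
  | tmul a r => simp [TensorProduct.equivFinsuppOfBasisLeft_apply_tmul]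

/-- Weil restriction: in a basis of `A`, a map `C → A ⊗ B` is a family of elements of `B` indexed by
`C × κ`, and being an algebra homomorphism is a system of polynomial equations. `R` is the
polynomial ring modulo these equations. -/
theorem exists_universal_algHom {k A : Type u} (C : Type u) [CommRing k] [CommRing A] [Algebra k A]
    [CommRing C] [Algebra k C] [Module.Free k A] [Module.Finite k A] :
    ∃ (R : Type u) (_ : CommRing R) (_ : Algebra k R) (w : C →ₐ[k] A ⊗[k] R),
      ∀ (B : Type u) [CommRing B] [Algebra k B] (f : C →ₐ[k] A ⊗[k] B), ∃! g : R →ₐ[k] B,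
        (Algebra.TensorProduct.map (.id k A) g).comp w = f := by
  classical
    let κ := Module.Free.ChooseBasisIndex k A
  let b : Module.Basis κ k A := Module.Free.chooseBasis k A
  let : Fintype κ := inferInstance
  let P := MvPolynomial (C × κ) k
  -- The generic value at `c`, with indeterminate coordinates.
  let θ (c : C) : A ⊗[k] P := ∑ i, b i ⊗ₜ MvPolynomial.X (c, i)
  -- The failures of additivity, of multiplicativity and of compatibility with scalars; the last
  -- include the conditions at `0` and `1`. `I` is generated by their coordinates.
  let Z : Set (A ⊗[k] P) := {z | (∃ c d, z = θ (c + d) - (θ c + θ d)) ∨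
    (∃ c d, z = θ (c * d) - (θ c * θ d)) ∨ ∃ r : k, z = θ (algebraMap k C r) - algebraMap k _ r}
  let I : Ideal P := Ideal.span {p | ∃ z ∈ Z, ∃ i, equivFinsuppOfBasisLeft b z i = p}
  have hZ {B : Type u} [CommRing B] [Algebra k B] (g : P →ₐ[k] B) :
      (∀ p ∈ I, g p = 0) ↔ ∀ z ∈ Z, Algebra.TensorProduct.map (.id k A) g z = 0 := by
    have : (∀ p ∈ I, g p = 0) ↔ I ≤ RingHom.ker g := Iff.rfl
    rw [this, Ideal.span_le]
    constructor
    · intro h z hz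
      apply (equivFinsuppOfBasisLeft b).injective
      ext i
      rw [equivFinsuppOfBasisLeft_map]
      simpa using h ⟨z, hz, i, rfl⟩
    · rintro h _ ⟨z, hz, i, rfl⟩
      change g _ = 0
      rw [← equivFinsuppOfBasisLeft_map, h z hz]
      simp
  have hθ {B : Type u} [CommRing B] [Algebra k B] (g : P →ₐ[k] B) (c : C) (i) :
      equivFinsuppOfBasisLeft b (Algebra.TensorProduct.map (.id k A) g (θ c)) i = g (.X (c, i)) := by
    rw [equivFinsuppOfBasisLeft_map]
    congr 1
    simp [θ, equivFinsuppOfBasisLeft_apply_tmul, Finsupp.single_apply]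
  let π : P →ₐ[k] P ⧸ I := Ideal.Quotient.mkₐ k I
  have h0 := (hZ π).1 fun p hp ↦ Ideal.Quotient.eq_zero_iff_mem.2 hp
  let M : A ⊗[k] P →ₐ[k] A ⊗[k] (P ⧸ I) := Algebra.TensorProduct.map (.id k A) π
  have hadd (c d : C) : M (θ (c + d)) = M (θ c) + M (θ d) := by
    rw [← map_add, ← sub_eq_zero, ← map_sub]
    exact h0 _ (.inl ⟨c, d, rfl⟩)
  have hmul (c d : C) : M (θ (c * d)) = M (θ c) * M (θ d) := by
    rw [← map_mul, ← sub_eq_zero, ← map_sub]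
    exact h0 _ (.inr (.inl ⟨c, d, rfl⟩))
  have halg (r : k) : M (θ (algebraMap k C r)) = M (algebraMap k (A ⊗[k] P) r) := by
    rw [← sub_eq_zero, ← map_sub]
    exact h0 _ (.inr (.inr ⟨r, rfl⟩))
  let w : C →ₐ[k] A ⊗[k] (P ⧸ I) :=
    { toFun c := M (θ c)
      map_one' := by simpa only [map_one] using (halg 1).trans (M.commutes 1)
      map_mul' := hmul
      map_zero' := by simpa only [map_zero] using halg 0
      map_add' := hadd
      commutes' r := (halg r).trans (M.commutes r) }
  have hw {B : Type u} [CommRing B] [Algebra k B] (g : P ⧸ I →ₐ[k] B) (c : C) (i) :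
      equivFinsuppOfBasisLeft b (Algebra.TensorProduct.map (.id k A) g (w c)) i =
        g (π (.X (c, i))) := by
    rw [equivFinsuppOfBasisLeft_map]
    exact congr_arg g (hθ π c i)
  refine ⟨P ⧸ I, inferInstance, inferInstance, w, fun B _ _ f ↦ ?_⟩
  let e : P →ₐ[k] B := MvPolynomial.aeval fun c ↦ equivFinsuppOfBasisLeft b (f c.1) c.2
  have he (c : C) : Algebra.TensorProduct.map (.id k A) e (θ c) = f c := by
    apply (equivFinsuppOfBasisLeft b).injective
    ext i
    rw [hθ, MvPolynomial.aeval_X]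
  have hI : ∀ p ∈ I, e p = 0 := by
    rw [hZ]
    rintro _ (⟨c, d, rfl⟩ | ⟨c, d, rfl⟩ | ⟨r, rfl⟩)
    · simp only [map_sub, map_add, he, sub_self]
    · simp only [map_sub, map_mul, he, sub_self]
    · simp only [map_sub, he, AlgHom.commutes, sub_self]
  refine ⟨Ideal.Quotient.liftₐ I e hI, ?_, ?_⟩
  · ext c
    apply (equivFinsuppOfBasisLeft b).injective
    ext i
    exact (hw _ c i).trans (MvPolynomial.aeval_X _ _)
  · rintro g rfl
    apply Ideal.Quotient.algHom_ext
    apply MvPolynomial.algHom_ext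
    rintro ⟨c, i⟩
    refine (hw g c i).symm.trans ?_
    have h : e (.X (c, i)) = _ := MvPolynomial.aeval_X _ _
    exact h.symm
end AlgebraicRestriction

section HomScheme
variable {k : Type u} [Field k]

open Functor in
theorem existsUnique_specFunctor_whiskerLeft {A D R : CommAlgCat.{u} k} (w : op A ⊗ op R ⟶ op D)
    (h : ∀ (B : CommAlgCat.{u} k) (f : op A ⊗ op B ⟶ op D), ∃! g : op B ⟶ op R, op A ◁ g ≫ w = f)
    (T : Over (Spec (.of k))) (hT : IsAffine T.left)
    (f : (specFunctor k).obj (op A) ⊗ T ⟶ (specFunctor k).obj (op D)) :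
    ∃! g : T ⟶ (specFunctor k).obj (op R), (specFunctor k).obj (op A) ◁ g ≫
      LaxMonoidal.μ (specFunctor k) (op A) (op R) ≫ (specFunctor k).map w = f := by
  obtain ⟨⟨B⟩, ⟨e⟩⟩ := exists_iso_algSpec hT
  obtain ⟨f', hf'⟩ := (specFunctor k).map_surjective
    (OplaxMonoidal.δ (specFunctor k) (op A) (op B) ≫ (specFunctor k).obj (op A) ◁ e.hom ≫ f)
  have key (g : op B ⟶ op R) : (specFunctor k).obj (op A) ◁ (e.inv ≫ (specFunctor k).map g) ≫
      LaxMonoidal.μ (specFunctor k) (op A) (op R) ≫ (specFunctor k).map w = f ↔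
      op A ◁ g ≫ w = f' := by
    rw [← (specFunctor k).map_injective.eq_iff, hf', (specFunctor k).map_comp,
      Functor.Monoidal.map_whiskerLeft, ← cancel_epi ((specFunctor k).obj (op A) ◁ e.hom),
      ← cancel_epi (OplaxMonoidal.δ (specFunctor k) (op A) (op B))]
    simp
  obtain ⟨g, hg, hu⟩ := h B f'
  refine ⟨e.inv ≫ (specFunctor k).map g, (key g).2 hg, fun g' hg' ↦ ?_⟩
  obtain ⟨g'', hg''⟩ := (specFunctor k).map_surjective (e.hom ≫ g')
  obtain rfl : g' = e.inv ≫ (specFunctor k).map g'' := by simp [hg'']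
  rw [hu g'' ((key g'').1 hg')]

/-- The algebra of a finite scheme over a field is finite free, so the Weil restriction gives the
universal morphism for affine `T`; gluing extends it to all `T`. -/
theorem exists_affine_homScheme {X Y : Over (Spec (.of k))} (hX : IsFinite X.hom)
    (hY : IsAffine Y.left) : ∃ (V : Over (Spec (.of k))) (v : X ⊗ V ⟶ Y), IsAffine V.left ∧
      ∀ (T : Over (Spec (.of k))) (f : X ⊗ T ⟶ Y), ∃! g : T ⟶ V, X ◁ g ≫ v = f := by
  have hX' : IsAffine X.left := isAffine_of_isAffineHom X.hom
  obtain ⟨⟨A⟩, ⟨eA⟩⟩ := exists_iso_algSpec hX'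
  obtain ⟨⟨D⟩, ⟨eD⟩⟩ := exists_iso_algSpec hY
  have h1 : IsFinite ((specFunctor k).obj (op A)).hom := by
    rw [← Over.w eA.hom]
    have : IsIso eA.hom.left := inferInstanceAs (IsIso ((Over.forget _).map eA.hom))
    exact MorphismProperty.comp_mem @IsFinite eA.hom.left X.hom inferInstance hX
  change IsFinite (Spec.map (CommRingCat.ofHom (algebraMap k A))) at h1
  rw [IsFinite.SpecMap_iff] at h1
  have : Module.Finite k A := RingHom.finite_algebraMap.1 h1
  obtain ⟨R, _, _, w, hw⟩ := exists_universal_algHom D (k := k) (A := A)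
  let w' : op A ⊗ op (CommAlgCat.of k R) ⟶ op D := (CommAlgCat.ofHom w).op
  have hw' (B : CommAlgCat.{u} k) (f : op A ⊗ op B ⟶ op D) :
      ∃! g : op B ⟶ op (CommAlgCat.of k R), op A ◁ g ≫ w' = f := by
    obtain ⟨g, hg, hu⟩ := hw B f.unop.hom
    refine ⟨(CommAlgCat.ofHom g).op, ?_, fun g' hg' ↦ ?_⟩
    · apply Quiver.Hom.unop_inj
      ext1
      exact hg
    · apply Quiver.Hom.unop_inj
      ext1
      exact hu _ (congr_arg (fun q ↦ q.unop.hom) hg')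
  let V := (specFunctor k).obj (op (CommAlgCat.of k R))
  let v : X ⊗ V ⟶ Y := eA.inv ▷ V ≫ Functor.LaxMonoidal.μ (specFunctor k) _ _ ≫
    (specFunctor k).map w' ≫ eD.hom
  have hv (T : Over (Spec (.of k))) (hT : IsAffine T.left) (f : X ⊗ T ⟶ Y) :
      ∃! g : T ⟶ V, X ◁ g ≫ v = f := by
    have key (g : T ⟶ V) : X ◁ g ≫ v = f ↔ (specFunctor k).obj (op A) ◁ g ≫
      Functor.LaxMonoidal.μ (specFunctor k) _ _ ≫ (specFunctor k).map w' =
        eA.hom ▷ T ≫ f ≫ eD.inv := by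
      rw [← cancel_epi (eA.hom ▷ T), ← cancel_mono eD.inv, ← whisker_exchange_assoc]
      simp [v]
    simp only [key]
    exact existsUnique_specFunctor_whiskerLeft w' hw' T hT _
  refine ⟨V, v, essImage_algSpec.1 ⟨_, ⟨Iso.refl _⟩⟩, fun T f ↦ ?_⟩
  -- Gluing is phrased for maps out of products with `T`, so `T ⟶ V` is rewritten as `𝟙_ ⊗ T ⟶ V`.
  obtain ⟨g, hg, hu⟩ := existsUnique_of_affine (Y₁ := 𝟙_ _) (Y₂ := X) (W₁ := V) (W₂ := Y)
    (fun T g ↦ X ◁ ((λ_ T).inv ≫ g) ≫ v) (fun T' T t g ↦ by simp) f fun U hU t ↦ by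
      obtain ⟨g, hg, hu⟩ := hv U hU (X ◁ t ≫ f)
      refine ⟨(λ_ U).hom ≫ g, by simpa using hg, fun g' hg' ↦ ?_⟩
      rw [← hu _ hg', Iso.hom_inv_id_assoc]
  refine ⟨(λ_ T).inv ≫ g, hg, fun g' hg' ↦ ?_⟩
  rw [← hu ((λ_ T).hom ≫ g') (by simpa using hg'), Iso.inv_hom_id_assoc]

end HomScheme

end

/-! ### Representing group schemes and passage from functors to groups -/

section

variable {S : Scheme.{u}} {k : Type u} [Field k]

theorem isHomFamily_iff_whiskerRight {C : Type*} [Category* C] [CartesianMonoidalCategory C]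
    {G H T : C} [MonObj G] [MonObj H] (f : G ⊗ T ⟶ H) :
    IsHomFamily f ↔ μ ▷ T ≫ f = (fst G G ▷ T ≫ f) * (snd G G ▷ T ≫ f) := by
  have e (z : G ⊗ G ⟶ G) : z ▷ T = lift (fst (G ⊗ G) T ≫ z) (snd (G ⊗ G) T) := by
    apply CartesianMonoidalCategory.hom_ext <;> simp
  rw [isHomFamily_iff, ← MonObj.comp_mul, ← e, ← e, ← e, ← MonObj.mul_eq_mul]

/-- The assignments `f ↦ f(xy)` and `f ↦ f(x) f(y)` are maps `a, b` between the affine schemes of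
morphisms out of `G` and out of `G × G`; multiplicative families are the points of their equalizer.
-/
theorem exists_affine_homFamilyScheme {G H : CommGrp (Over (Spec (.of k)))} (hG : IsFinite G.X.hom)
    (hH : IsAffine H.X.left) :
    ∃ (W : Over (Spec (.of k))) (w : G.X ⊗ W ⟶ H.X), IsAffine W.left ∧ IsHomFamily w ∧
      ∀ (T : Over (Spec (.of k))) (f : G.X ⊗ T ⟶ H.X), IsHomFamily f →
        ∃! g : T ⟶ W, G.X ◁ g ≫ w = f := by
  have hGG : IsFinite (G.X ⊗ G.X).hom :=
    MorphismProperty.comp_mem @IsFinite (pullback.fst G.X.hom G.X.hom) G.X.hom inferInstance hG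
  obtain ⟨V, v, hV, h⟩ := exists_affine_homScheme hG hH
  obtain ⟨V', v', hV', h'⟩ := exists_affine_homScheme hGG hH
  obtain ⟨a, ha, -⟩ := h' V (μ ▷ V ≫ v)
  obtain ⟨b, hb, -⟩ := h' V ((fst G.X G.X ▷ V ≫ v) * (snd G.X G.X ▷ V ≫ v))
  have key {T : Over (Spec (.of k))} (g : T ⟶ V) :
      IsHomFamily (G.X ◁ g ≫ v) ↔ g ≫ a = g ≫ b := by
    have e : IsHomFamily (G.X ◁ g ≫ v) ↔
        (G.X ⊗ G.X) ◁ (g ≫ a) ≫ v' = (G.X ⊗ G.X) ◁ (g ≫ b) ≫ v' := by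
      rw [isHomFamily_iff_whiskerRight, MonoidalCategory.whiskerLeft_comp_assoc,
        MonoidalCategory.whiskerLeft_comp_assoc, ha, hb, MonObj.comp_mul, whisker_exchange_assoc,
        whisker_exchange_assoc, whisker_exchange_assoc]
    rw [e]
    exact ⟨fun e ↦ (h' T _).unique e rfl, fun e ↦ by rw [e]⟩
  -- The equalizer as the preimage of the diagonal under `(a, b)`, which shows that it is affine.
  have hP := IsPullback.of_hasPullback (lift a b) (lift (𝟙 V') (𝟙 V'))
  have hVV : IsAffine (V' ⊗ V').left := inferInstanceAs (IsAffine (pullback V'.hom V'.hom))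
  have he : pullback.fst (lift a b) (lift (𝟙 V') (𝟙 V')) ≫ a =
      pullback.fst (lift a b) (lift (𝟙 V') (𝟙 V')) ≫ b := by
    have h1 := hP.w =≫ fst _ _
    have h2 := hP.w =≫ snd _ _
    rw [Category.assoc, Category.assoc, lift_fst, lift_fst] at h1
    rw [Category.assoc, Category.assoc, lift_snd, lift_snd] at h2
    rw [h1, h2]
  have hA := isAffine_of_isPullback hP hV hV' hVV
  generalize pullback.fst (lift a b) (lift (𝟙 V') (𝟙 V')) = p at *
  generalize pullback.snd (lift a b) (lift (𝟙 V') (𝟙 V')) = q at *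
  refine ⟨_, G.X ◁ p ≫ v, hA, (key _).2 he, fun T f hf ↦ ?_⟩
  obtain ⟨g, rfl, hu⟩ := h T f
  have hg := (key g).1 hf
  have hl : g ≫ lift a b = (g ≫ a) ≫ lift (𝟙 V') (𝟙 V') := by
    rw [comp_lift, comp_lift, hg, Category.comp_id]
  refine ⟨hP.lift _ _ hl, ?_, fun g' hg' ↦ ?_⟩
  · dsimp only
    rw [← MonoidalCategory.whiskerLeft_comp_assoc, hP.lift_fst]
  · have h2 : g' ≫ p = g :=
      hu _ ((MonoidalCategory.whiskerLeft_comp_assoc _ _ _ _).trans hg')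
    have h1 := hP.w =≫ fst _ _
    rw [Category.assoc, Category.assoc, lift_fst, lift_fst, Category.comp_id] at h1
    apply hP.hom_ext
    · rw [hP.lift_fst, h2]
    · rw [hP.lift_snd, ← h1, ← Category.assoc, h2]

/-- Yoneda: a representing object inherits a group structure from the group-valued functor, and the
representation becomes a group isomorphism. -/
theorem exists_iso_functorOfPoints (F : (Over S)ᵒᵖ ⥤ CommGrpCat.{u}) {X : Over S}
    (α : (F ⋙ forget _).RepresentableBy X) :
    ∃ G : CommGrp (Over S), G.X = X ∧ Nonempty ((functorOfPoints S).obj G ≅ F) := by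
  let := CommGrpObj.ofRepresentableBy X F α
  have hmul (T : Over S) (x y : T ⟶ X) : (α.homEquiv (x * y) : F.obj (op T)) =
      (α.homEquiv x : F.obj (op T)) * (α.homEquiv y : F.obj (op T)) :=
    ((yonedaGrpObjIsoOfRepresentableBy X (F ⋙ forget₂ CommGrpCat GrpCat) α).hom.app
      (op T)).hom.map_mul x y
  have hnat (T T' : Over S) (t : T' ⟶ T) (x : T ⟶ X) :
      (α.homEquiv (t ≫ x) : F.obj (op T')) = (F.map t.op).hom (α.homEquiv x) :=
    α.homEquiv_comp t x
  let e (T : Over S) : (T ⟶ X) ≃* F.obj (op T) := ⟨α.homEquiv, hmul T⟩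
  refine ⟨⟨X⟩, rfl, ?_⟩
  refine ⟨NatIso.ofComponents (fun T ↦ MulEquiv.toCommGrpIso
    (X := ((functorOfPoints S).obj ⟨X⟩).obj T) (e T.unop)) ?_⟩
  intro T T' t
  exact CommGrpCat.hom_ext (MonoidHom.ext fun x ↦ hnat _ _ t.unop x)

theorem exists_iso_functorOfPoints_of_bijective (F : (Over S)ᵒᵖ ⥤ CommGrpCat.{u}) {X : Over S}
    (x : F.obj (op X)) (h : ∀ T : Over S, Function.Bijective fun g : T ⟶ X ↦ (F.map g.op).hom x) :
    ∃ G : CommGrp (Over S), G.X = X ∧ Nonempty ((functorOfPoints S).obj G ≅ F) :=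
  exists_iso_functorOfPoints F
    { homEquiv {T} := Equiv.ofBijective _ (h T)
      homEquiv_comp t g := congr_arg (fun f ↦ f.hom x) (F.map_comp g.op t.op) }


section
attribute [local irreducible] restrict

theorem innerHomPresheaf_map_hom {G H : CommGrp (Over S)} {W T : Over S} (ω : HomOver G H W)
    (g : T ⟶ W) : ((innerHomPresheaf G H).map g.op).hom ω = restrict G H g ω := (rfl)

end

theorem exists_iso_innerHomPresheaf {G H : CommGrp (Over S)} {W : Over S} (ω : HomOver G H W)
    (h : ∀ T : Over S, ∀ φ : HomOver G H T, ∃! g : T ⟶ W, restrict G H g ω = φ) :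
    ∃ G' : CommGrp (Over S), G'.X = W ∧
      Nonempty ((functorOfPoints S).obj G' ≅ innerHomPresheaf G H) := by
  apply exists_iso_functorOfPoints_of_bijective (innerHomPresheaf G H) (X := W) (x := ω)
  intro T
  rw [Function.bijective_iff_existsUnique]
  intro φ
  obtain ⟨g, hg, hu⟩ := h T φ
  exact ⟨g, (innerHomPresheaf_map_hom ω g).trans hg,
    fun g' hg' ↦ hu g' ((innerHomPresheaf_map_hom ω g').symm.trans hg')⟩

theorem exists_representing_group {G H : CommGrp (Over (Spec (.of k)))} (hG : IsFinite G.X.hom)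
    (hH : IsAffine H.X.left) : ∃ W : CommGrp (Over (Spec (.of k))), IsAffine W.X.left ∧
      Nonempty ((functorOfPoints _).obj W ≅ innerHomPresheaf G H) := by
  obtain ⟨W, w, hW, hw, h⟩ := exists_affine_homFamilyScheme hG hH
  obtain ⟨ω, rfl⟩ := exists_toFamily_eq hw
  have hb (T : Over (Spec (.of k))) (φ : HomOver G H T) : ∃! g : T ⟶ W, restrict G H g ω = φ := by
    simp only [← toFamily_injective.eq_iff, toFamily_restrict]
    exact h T _ (isHomFamily_toFamily φ)
  obtain ⟨G', rfl, e⟩ := exists_iso_innerHomPresheaf ω hb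
  exact ⟨G', hW, e⟩

instance : (functorOfPoints S).Faithful where
  map_injective {G H} f g h := by
    refine InducedCategory.hom_ext (Grp.hom_ext _ _ ?_)
    have e : 𝟙 G.X ≫ f.hom.hom.hom = 𝟙 G.X ≫ g.hom.hom.hom :=
      congr_arg (fun α ↦ (α.app (op G.X)).hom (𝟙 G.X)) h
    rwa [Category.id_comp, Category.id_comp] at e

/-- By Yoneda a transformation is composition with the image of the identity point, and its
additivity makes that morphism a homomorphism. -/
instance : (functorOfPoints S).Full where
  map_surjective {G H} α := by
    let f : G.X ⟶ H.X := (α.app (op G.X)).hom (𝟙 G.X)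
    have hf (Y : Over S) (x : Y ⟶ G.X) : (α.app (op Y)).hom x = x ≫ f := by
      have := congr_arg (fun β ↦ β.hom (𝟙 G.X)) (α.naturality x.op)
      refine Eq.trans ?_ this
      exact congr_arg _ (Category.comp_id x).symm
    have : IsMonHom f := isMonHom_of_comp_mul f fun Y x y ↦ by
      rw [← hf, ← hf, ← hf]
      exact (α.app (op Y)).hom.map_mul x y
    refine ⟨InducedCategory.homMk (Grp.ofHom f), ?_⟩
    ext T : 2
    exact CommGrpCat.hom_ext (MonoidHom.ext fun x ↦ (hf _ x).symm)

/-- Full faithfulness of the functor of points makes objectwise representability functorial: `Φ`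
lands in the essential image, on which an inverse equivalence exists. -/
theorem exists_represents {D : Type*} [Category* D]
    (Φ : D ⥤ (Over (Spec (.of k)))ᵒᵖ ⥤ CommGrpCat.{u})
    (h : ∀ d, ∃ W : CommGrp (Over (Spec (.of k))), IsAffine W.X.left ∧
      Nonempty ((functorOfPoints _).obj W ≅ Φ.obj d)) : ∃ F : D ⥤ AffGrp k, Represents F Φ := by
  let J : AffGrp k ⥤ _ := (isAffineGroup k).ι ⋙ functorOfPoints (Spec (.of k))
  let L : D ⥤ J.EssImageSubcategory := J.essImage.lift Φ fun d ↦ by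
    obtain ⟨W, hW, e⟩ := h d
    exact ⟨⟨W, hW⟩, e⟩
  refine ⟨L ⋙ J.toEssImage.inv, ⟨?_⟩⟩
  exact Functor.isoWhiskerLeft L (Functor.isoWhiskerLeft J.toEssImage.inv J.toEssImageCompι.symm ≪≫
    Functor.isoWhiskerRight J.toEssImage.asEquivalence.counitIso J.essImage.ι)

/-- A fully faithful functor reflects limits, so preservation by `Φ` passes to `F`. -/
theorem Represents.preservesFiniteLimits {D : Type*} [Category* D] {F : D ⥤ AffGrp k}
    {Φ : D ⥤ (Over (Spec (.of k)))ᵒᵖ ⥤ CommGrpCat.{u}} (h : Represents F Φ)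
    [PreservesFiniteLimits Φ] : PreservesFiniteLimits F := by
  let J : AffGrp k ⥤ _ := (isAffineGroup k).ι ⋙ functorOfPoints (Spec (.of k))
  obtain ⟨e⟩ := h
  have : PreservesFiniteLimits (F ⋙ J) := preservesFiniteLimits_of_natIso e.symm
  have : ReflectsFiniteLimits J := inferInstance
  exact preservesFiniteLimits_of_reflects_of_preserves F J

theorem IsLeftExactSeq.of_iso {D : Type*} [Category* D] {Φ Ψ : D ⥤ (Over S)ᵒᵖ ⥤ CommGrpCat.{u}}
    (e : Ψ ≅ Φ) {X Y Z : D} {f : X ⟶ Y} {g : Y ⟶ Z} (h : IsLeftExactSeq (Φ.map f) (Φ.map g)) :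
    IsLeftExactSeq (Ψ.map f) (Ψ.map g) := by
  rw [isLeftExactSeq_iff] at h ⊢
  intro T
  obtain ⟨h₁, h₂, h₃⟩ := h T
  have hbij (X : D) : Function.Bijective ((e.hom.app X).app (op T)).hom :=
    ConcreteCategory.bijective_of_isIso ((e.hom.app X).app (op T))
  have hnat {X Y : D} (f : X ⟶ Y) (x) :
      ((e.hom.app Y).app (op T)).hom (((Ψ.map f).app (op T)).hom x) =
      ((Φ.map f).app (op T)).hom (((e.hom.app X).app (op T)).hom x) := by
    have := congr_arg (fun α ↦ (α.app (op T)).hom x) (e.hom.naturality f)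
    exact this
  refine ⟨fun x y hxy ↦ ?_, fun x ↦ ?_, fun y hy ↦ ?_⟩
  · apply (hbij X).injective
    apply h₁
    rw [← hnat, hxy, hnat]
  · apply (hbij Z).injective
    rw [hnat, hnat, h₂, map_one]
  · obtain ⟨x, hx⟩ := h₃ (((e.hom.app Y).app (op T)).hom y) (by rw [← hnat, hy, map_one])
    obtain ⟨x, rfl⟩ := (hbij X).surjective x
    exact ⟨x, (hbij Y).injective ((hnat _ _).trans hx)⟩

/-- Exactness on `W`-points for every `W` is the universal property of the fibre over the unit
section. -/
theorem isKernel_of_isLeftExactSeq {N G Q : CommGrp (Over S)} {i : N ⟶ G} {π : G ⟶ Q}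
    (h : IsLeftExactSeq ((functorOfPoints S).map i) ((functorOfPoints S).map π)) :
    IsKernel i π := by
  rw [isLeftExactSeq_iff] at h
  refine isPullback_of_existsUnique ?_ fun W x y e ↦ ?_
  · have := (h N.X).2.1 (𝟙 N.X)
    refine Eq.trans ?_ this
    exact congr_arg (· ≫ π.hom.hom.hom) (Category.id_comp _).symm
  · obtain ⟨z, hz⟩ := (h W).2.2 x (e.trans (congr_arg (· ≫ η[Q.X]) (toUnit_unique _ _)))
    refine ⟨z, ⟨hz, toUnit_unique _ _⟩, fun z' hz' ↦ (h W).1 (hz'.1.trans hz.symm)⟩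

theorem Represents.isKernel {D : Type*} [Category* D] {F : D ⥤ AffGrp k}
    {Φ : D ⥤ (Over (Spec (.of k)))ᵒᵖ ⥤ CommGrpCat.{u}} (h : Represents F Φ) {X Y Z : D} {f : X ⟶ Y}
    {g : Y ⟶ Z} (hfg : IsLeftExactSeq (Φ.map f) (Φ.map g)) :
    IsKernel (F.map f).hom (F.map g).hom := by
  obtain ⟨e⟩ := h
  exact isKernel_of_isLeftExactSeq (IsLeftExactSeq.of_iso e hfg)

end

end GroupScheme

end

theorem mainTheorem12 (k : Type u) [Field k] (H : AffGrp k) :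
    -- the functor `Hom(-, H)` on all affine commutative group schemes
    (PreservesFiniteLimits (homInto H) ∧
      ∀ ⦃N G Q : AffGrp k⦄ (i : N ⟶ G) (π : G ⟶ Q), IsShortExact i.hom π.hom →
        IsLeftExactSeq ((homInto H).map π.op) ((homInto H).map i.op)) ∧
    -- the functor `Hom(-, H)` from finite commutative group schemes to affine ones
    ((∃ F : (FinGrp k)ᵒᵖ ⥤ AffGrp k, Represents F (finHomInto H)) ∧
      ∀ F : (FinGrp k)ᵒᵖ ⥤ AffGrp k, Represents F (finHomInto H) →
        PreservesFiniteLimits F ∧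
        ∀ ⦃N G Q : FinGrp k⦄ (i : N ⟶ G) (π : G ⟶ Q), IsShortExact i.hom π.hom →
          IsKernel (F.map π.op).hom (F.map i.op).hom) ∧
    -- the functor `Hom(H, -)` on all affine commutative group schemes
    (PreservesFiniteLimits (homFrom H) ∧
      ∀ ⦃N G Q : AffGrp k⦄ (i : N ⟶ G) (π : G ⟶ Q), IsKernel i.hom π.hom →
        IsLeftExactSeq ((homFrom H).map i) ((homFrom H).map π)) ∧
    -- the functor `Hom(H, -)` with values in affine commutative group schemes, for finite `H`
    (isFiniteGroup k H.obj →
      (∃ F : AffGrp k ⥤ AffGrp k, Represents F (homFrom H)) ∧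
      ∀ F : AffGrp k ⥤ AffGrp k, Represents F (homFrom H) →
        PreservesFiniteLimits F ∧
        ∀ ⦃N G Q : AffGrp k⦄ (i : N ⟶ G) (π : G ⟶ Q), IsKernel i.hom π.hom →
          IsKernel (F.map i).hom (F.map π).hom) := by
  have : PreservesFiniteLimits (homInto H) := preservesFiniteLimits_homInto H
  have : PreservesFiniteLimits (finHomInto H) := preservesFiniteLimits_finHomInto H
  have : PreservesFiniteLimits (homFrom H) := preservesFiniteLimits_homFrom H
  refine ⟨⟨inferInstance, fun N G Q i π h ↦ ?_⟩, ⟨?_, fun F hF ↦ ⟨hF.preservesFiniteLimits,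
    fun N G Q i π h ↦ ?_⟩⟩, ⟨inferInstance, fun N G Q i π h ↦ ?_⟩, fun hfin ↦ ⟨?_, fun F hF ↦
    ⟨hF.preservesFiniteLimits, fun N G Q i π h ↦ ?_⟩⟩⟩
  · exact h.isLeftExactSeq_innerHomMapLeft H.property G.property Q.property
  · exact exists_represents _ fun G ↦ exists_representing_group G.unop.property H.property
  · refine hF.isKernel ?_
    exact h.isLeftExactSeq_innerHomMapLeft H.property (isFiniteGroup_le k _ G.property)
      (isFiniteGroup_le k _ Q.property)
  · exact isLeftExactSeq_innerHomMapRight h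
  · exact exists_represents _ fun G ↦ exists_representing_group hfin G.property
  · exact hF.isKernel (isLeftExactSeq_innerHomMapRight h)
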